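/- Let $\Omega\subset\mathbb R^2$ be a bounded open set with smooth boundary, and let $D$ be a connected open set with $\overline D\subset\Omega$. Let $0<\alpha<\pi$. Suppose that $\partial D$ is smooth except for one corner of angle $\alpha$ at the origin, and that for some $R_0>0$ $$D\cap B_{R_0}=\{(r\cos\theta,r\sin\theta)\;:\;0<r<R_0,\ |\theta|<\alpha/2\},$$ where $B_{R_0}$ is the open disc of radius $R_0$ centred at the origin. Let $H^1_0(\Omega)$ be the real Sobolev space with inner product $\langle u,v\rangle=\int_\Omega\nabla u\cdot\nabla v\,dx$, and let $T_D:H^1_0(\Omega)\to H^1_0(\Omega)$ be the Poincaré variational operator, defined by $$\int_\Omega\nabla T_Du\cdot\nabla v\,dx=\int_D\nabla u\cdot\nabla v\,dx\qquad\text{for all }v\in H^1_0(\Omega).$$ Let $\sigma_{ess}(T_D)$ be the set of $\beta\in\mathbb R$ that admit a singular Weyl sequence, that is, a sequence $(u_n)$ in $H^1_0(\Omega)$ with $\|u_n\|_{H^1_0}=1$, with $(\beta I-T_D)u_n\to0$ strongly in $H^1_0(\Omega)$, and with $u_n\rightharpoonup0$ weakly in $H^1_0(\Omega)$. Put $\lambda_+=-\lambda_-=\frac12\left(1-\frac{\alpha}{\pi}\right)$.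 Then for every $\lambda\in[\lambda_-,\lambda_+]$, the number $\beta=\frac12-\lambda$ belongs to $\sigma_{ess}(T_D)$. -/

import Mathlib

open MeasureTheory Set Filter Topology
open scoped ContDiff

/-- The Euclidean plane `ℝ²`. -/
abbrev Plane : Type := EuclideanSpace ℝ (Fin 2)

/-- A bounded open subset of the plane. -/
structure BoundedOpen where
  carrier : Set Plane
  isOpen : IsOpen carrier
  isBounded : Bornology.IsBounded carrier

/-- Lebesgue measure on `Ω`. -/
noncomputable abbrev volOn (Ω : BoundedOpen) : Measure Plane := volume.restrict Ω.carrier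

/-- The pairs `(φ, ∇φ)`, `φ ∈ C_c^∞(Ω)`, inside `L²(Ω) × L²(Ω; ℝ²)`. -/
noncomputable def testGraph (Ω : BoundedOpen) :
    Submodule ℝ (Lp ℝ 2 (volOn Ω) × Lp Plane 2 (volOn Ω)) where
  carrier := {p | ∃ φ : Plane → ℝ, ContDiff ℝ ∞ φ ∧ HasCompactSupport φ ∧
    tsupport φ ⊆ Ω.carrier ∧ p.1 =ᵐ[volOn Ω] φ ∧ p.2 =ᵐ[volOn Ω] gradient φ}
  zero_mem' := by
    refine ⟨0, contDiff_const, HasCompactSupport.zero, by simp [tsupport], ?_, ?_⟩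
    · exact Lp.coeFn_zero ℝ 2 (volOn Ω)
    · refine (Lp.coeFn_zero Plane 2 (volOn Ω)).trans (Eventually.of_forall fun x => ?_)
      simp [gradient]
  add_mem' := by
    rintro p q ⟨φ, h1, h2, h3, h4, h5⟩ ⟨ψ, k1, k2, k3, k4, k5⟩
    refine ⟨φ + ψ, h1.add k1, h2.add k2,
      (tsupport_add φ ψ).trans (union_subset h3 k3), ?_, ?_⟩
    · exact (Lp.coeFn_add p.1 q.1).trans (h4.add k4)
    · refine (Lp.coeFn_add p.2 q.2).trans ((h5.add k5).trans (Eventually.of_forall fun x => ?_))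
      have a := (h1.differentiable (by simp)) x
      have b := (k1.differentiable (by simp)) x
      simp [gradient, fderiv_add a b]
  smul_mem' := by
    rintro c p ⟨φ, h1, h2, h3, h4, h5⟩
    refine ⟨c • φ, h1.const_smul c, h2.smul_left (f := fun _ => c),
      (tsupport_smul_subset_right (fun _ => c) φ).trans h3, ?_, ?_⟩
    · exact (Lp.coeFn_smul c p.1).trans (h4.const_smul c)
    · refine (Lp.coeFn_smul c p.2).trans ((h5.const_smul c).trans
        (Eventually.of_forall fun x => ?_))
      have a := (h1.differentiable (by simp)) x
      simp [gradient, fderiv_const_smul a]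

/-- The Poincaré inequality for test functions. -/
theorem testGraph_poincare (Ω : BoundedOpen) : ∃ C : ℝ, ∀ p ∈ testGraph Ω, ‖p.1‖ ≤ C * ‖p.2‖ := by
  set K : ENNReal := (eLpNormLESNormFDerivOneConst (volume : Measure Plane) 2 : ENNReal) *
    (volOn Ω univ) ^ (1 / (1 : ENNReal).toReal - 1 / (2 : ENNReal).toReal) with hK
  have hKtop : K ≠ ⊤ := by
    refine ENNReal.mul_ne_top ENNReal.coe_ne_top (ENNReal.rpow_ne_top_of_nonneg (by norm_num) ?_)
    rw [Measure.restrict_apply_univ]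
    exact Ω.isBounded.measure_lt_top.ne
  refine ⟨K.toReal, ?_⟩
  rintro p ⟨φ, h1, h2, h3, h4, h5⟩
  have hφ : ContDiff ℝ 1 φ := h1.of_le (by simp)
  have e1 : eLpNorm φ 2 volume ≤
      eLpNormLESNormFDerivOneConst (volume : Measure Plane) 2 * eLpNorm (fderiv ℝ φ) 1 volume := by
    refine eLpNorm_le_eLpNorm_fderiv_one volume hφ h2 (p := 2) ?_
    simp only [finrank_euclideanSpace, Fintype.card_fin, Nat.cast_ofNat]
    exact NNReal.HolderConjugate.two_two
  have hgr : ∀ x, ‖gradient φ x‖ = ‖fderiv ℝ φ x‖ := fun x => by simp [gradient]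
  have e2 : eLpNorm (fderiv ℝ φ) 1 volume = eLpNorm (gradient φ) 1 (volOn Ω) := by
    have hs : Function.support (gradient φ) ⊆ Ω.carrier := fun x hx => by
      refine h3 (support_fderiv_subset ℝ ?_)
      rw [Function.mem_support] at hx ⊢
      rwa [← norm_ne_zero_iff, ← hgr, norm_ne_zero_iff]
    rw [eLpNorm_restrict_eq_of_support_subset hs]
    exact eLpNorm_congr_norm_ae (Eventually.of_forall fun x => (hgr x).symm)
  have e3 : eLpNorm (gradient φ) 1 (volOn Ω) ≤ eLpNorm (gradient φ) 2 (volOn Ω) *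
      (volOn Ω univ) ^ (1 / (1 : ENNReal).toReal - 1 / (2 : ENNReal).toReal) := by
    refine eLpNorm_le_eLpNorm_mul_rpow_measure_univ (by norm_num) ?_
    exact (Lp.aestronglyMeasurable p.2).congr h5
  have e4 : eLpNorm p.1 2 (volOn Ω) ≤ K * eLpNorm p.2 2 (volOn Ω) := by
    rw [eLpNorm_congr_ae h4, eLpNorm_congr_ae h5]
    calc eLpNorm φ 2 (volOn Ω) ≤ eLpNorm φ 2 volume :=
          eLpNorm_mono_measure φ Measure.restrict_le_self
      _ ≤ _ := e1
      _ ≤ eLpNormLESNormFDerivOneConst (volume : Measure Plane) 2 *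
          (eLpNorm (gradient φ) 2 (volOn Ω) *
            (volOn Ω univ) ^ (1 / (1 : ENNReal).toReal - 1 / (2 : ENNReal).toReal)) := by
        rw [e2]
        gcongr
      _ = K * eLpNorm (gradient φ) 2 (volOn Ω) := by
        rw [hK, mul_assoc, mul_comm (eLpNorm (gradient φ) 2 (volOn Ω))]
  rw [Lp.norm_def, Lp.norm_def, ← ENNReal.toReal_mul]
  exact ENNReal.toReal_mono (ENNReal.mul_ne_top hKtop (Lp.eLpNorm_ne_top _)) e4

/-- The Sobolev space `H^1_0(Ω)` of real functions: the closure of `C_c^∞(Ω)` in the `H^1` norm.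
An element is stored as the pair (function, weak gradient) in `L²(Ω) × L²(Ω; ℝ²)`. -/
def SobolevH10 (Ω : BoundedOpen) : Type := ↥(testGraph Ω).topologicalClosure

namespace SobolevH10

variable {Ω : BoundedOpen}

noncomputable instance : AddCommGroup (SobolevH10 Ω) :=
  inferInstanceAs (AddCommGroup ↥(testGraph Ω).topologicalClosure)

noncomputable instance : Module ℝ (SobolevH10 Ω) :=
  inferInstanceAs (Module ℝ ↥(testGraph Ω).topologicalClosure)

/-- The identification of `H^1_0(Ω)` with the closed subspace of `L² × L²` defining it. -/
noncomputable def toPair : SobolevH10 Ω ≃ₗ[ℝ] ↥(testGraph Ω).topologicalClosure :=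
  LinearEquiv.refl ℝ _

/-- The function underlying an element of `H^1_0(Ω)`. -/
noncomputable def toFn : SobolevH10 Ω →ₗ[ℝ] Lp ℝ 2 (volOn Ω) :=
  LinearMap.fst ℝ _ _ ∘ₗ (testGraph Ω).topologicalClosure.subtype ∘ₗ toPair.toLinearMap

/-- The (weak) gradient of an element of `H^1_0(Ω)`. -/
noncomputable def grad : SobolevH10 Ω →ₗ[ℝ] Lp Plane 2 (volOn Ω) :=
  LinearMap.snd ℝ _ _ ∘ₗ (testGraph Ω).topologicalClosure.subtype ∘ₗ toPair.toLinearMap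

theorem poincare (Ω : BoundedOpen) :
    ∃ C : ℝ, ∀ u : SobolevH10 Ω, ‖toFn u‖ ≤ C * ‖grad u‖ := by
  obtain ⟨C, hC⟩ := testGraph_poincare Ω
  refine ⟨C, fun u => ?_⟩
  have hcl : IsClosed {p : Lp ℝ 2 (volOn Ω) × Lp Plane 2 (volOn Ω) | ‖p.1‖ ≤ C * ‖p.2‖} :=
    isClosed_le (by fun_prop) (by fun_prop)
  exact closure_minimal (fun p hp => hC p hp) hcl (toPair u).2

/-- The Dirichlet inner product `⟨u, v⟩ = ∫_Ω ∇u · ∇v dx` on `H^1_0(Ω)`. -/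
noncomputable instance core : InnerProductSpace.Core ℝ (SobolevH10 Ω) where
  inner u v := ∫ x in Ω.carrier, inner ℝ (grad u x) (grad v x)
  conj_inner_symm u v := inner_conj_symm (𝕜 := ℝ) (grad u) (grad v)
  re_inner_nonneg u := inner_self_nonneg (𝕜 := ℝ) (x := grad u)
  add_left u v w := by
    have h := inner_add_left (𝕜 := ℝ) (grad u) (grad v) (grad w)
    rw [← map_add] at h
    exact h
  smul_left u v r := by
    have h := inner_smul_left (𝕜 := ℝ) (grad u) (grad v) r
    rw [← map_smul] at h
    exact h
  definite u hu := by
    have h : grad u = 0 := inner_self_eq_zero (𝕜 := ℝ).1 hu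
    obtain ⟨C, hC⟩ := poincare Ω
    have h' : toFn u = 0 := by
      have := hC u
      rw [h, norm_zero, mul_zero] at this
      exact norm_le_zero_iff.1 this
    exact Subtype.ext (Prod.ext h' h)

noncomputable instance : NormedAddCommGroup (SobolevH10 Ω) :=
  InnerProductSpace.Core.toNormedAddCommGroup (𝕜 := ℝ) (cd := core)

noncomputable instance : InnerProductSpace ℝ (SobolevH10 Ω) :=
  InnerProductSpace.ofCore core.toCore

theorem inner_eq (u v : SobolevH10 Ω) :
    inner ℝ u v = ∫ x in Ω.carrier, inner ℝ (grad u x) (grad v x) := rfl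

theorem norm_eq (u : SobolevH10 Ω) : ‖u‖ = ‖grad u‖ := by
  have h : inner ℝ u u = inner ℝ (grad u) (grad u) := rfl
  rw [real_inner_self_eq_norm_sq, real_inner_self_eq_norm_sq] at h
  exact (sq_eq_sq₀ (norm_nonneg _) (norm_nonneg _)).1 h

instance : CompleteSpace (SobolevH10 Ω) := by
  obtain ⟨C, hC⟩ := poincare Ω
  let e : SobolevH10 Ω ≃L[ℝ] ↥(testGraph Ω).topologicalClosure :=
    toPair.toContinuousLinearEquivOfBounds (max C 1) 1
      (fun u => by
        rw [norm_eq]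
        refine max_le ?_ ?_
        · exact (hC u).trans (mul_le_mul_of_nonneg_right (le_max_left _ _) (norm_nonneg _))
        · exact (one_mul ‖grad u‖).symm.le.trans
            (mul_le_mul_of_nonneg_right (le_max_right _ _) (norm_nonneg _)))
      (fun p => by
        rw [norm_eq, one_mul]
        exact le_max_right _ _)
  have : CompleteSpace ↥(testGraph Ω).topologicalClosure :=
    (testGraph Ω).isClosed_topologicalClosure.completeSpace_coe
  exact (completeSpace_congr (e := e) e.isUniformEmbedding).2 this

theorem integrable_inner_grad (u v : SobolevH10 Ω) :
    Integrable (fun x => inner ℝ (grad u x) (grad v x)) (volOn Ω) :=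
  L2.integrable_inner (𝕜 := ℝ) (grad u) (grad v)

theorem norm_integral_inner_grad_le (D : Set Plane) (u v : SobolevH10 Ω) :
    ‖∫ x in D, inner ℝ (grad u x) (grad v x) ∂(volOn Ω)‖ ≤ ‖u‖ * ‖v‖ := by
  have hu : MemLp (fun x => ‖grad u x‖) 2 (volOn Ω) := (Lp.memLp (grad u)).norm
  have hv : MemLp (fun x => ‖grad v x‖) 2 (volOn Ω) := (Lp.memLp (grad v)).norm
  calc ‖∫ x in D, inner ℝ (grad u x) (grad v x) ∂(volOn Ω)‖
      ≤ ∫ x in D, ‖(inner ℝ (grad u x) (grad v x) : ℝ)‖ ∂(volOn Ω) :=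
        norm_integral_le_integral_norm _
    _ ≤ ∫ x, ‖(inner ℝ (grad u x) (grad v x) : ℝ)‖ ∂(volOn Ω) :=
        integral_mono_measure Measure.restrict_le_self
          (Eventually.of_forall fun x => norm_nonneg _) (integrable_inner_grad u v).norm
    _ ≤ ∫ x, ‖grad u x‖ * ‖grad v x‖ ∂(volOn Ω) :=
        integral_mono (integrable_inner_grad u v).norm (hu.integrable_mul hv)
          fun x => norm_inner_le_norm _ _
    _ = inner ℝ (hu.toLp _) (hv.toLp _) := by
        rw [L2.inner_def]
        refine integral_congr_ae ?_
        filter_upwards [hu.coeFn_toLp, hv.coeFn_toLp] with x h1 h2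
        rw [h1, h2, real_inner_eq_re_inner]
        simp [mul_comm]
    _ ≤ ‖hu.toLp _‖ * ‖hv.toLp _‖ := real_inner_le_norm _ _
    _ = ‖u‖ * ‖v‖ := by
        rw [norm_eq, norm_eq, Lp.norm_toLp, Lp.norm_toLp, eLpNorm_norm, eLpNorm_norm,
          ← Lp.norm_def, ← Lp.norm_def]

/-- The bounded bilinear form `(u, v) ↦ ∫_D ∇u · ∇v dx` on `H^1_0(Ω)`, for `D ⊆ Ω`
(in general, the integral is over `D ∩ Ω`). -/
noncomputable def formOn (Ω : BoundedOpen) (D : Set Plane) :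
    SobolevH10 Ω →L[ℝ] SobolevH10 Ω →L[ℝ] ℝ :=
  LinearMap.mkContinuous₂
    (LinearMap.mk₂ ℝ
      (fun u v => ∫ x in D, inner ℝ (grad u x) (grad v x) ∂(volOn Ω))
      (fun u u' v => by
        rw [← integral_add (integrable_inner_grad u v).restrict
          (integrable_inner_grad u' v).restrict]
        refine integral_congr_ae (ae_restrict_of_ae ?_)
        rw [map_add]
        filter_upwards [Lp.coeFn_add (grad u) (grad u')] with x hx
        rw [hx, Pi.add_apply, inner_add_left])
      (fun c u v => by
        rw [← integral_smul]
        refine integral_congr_ae (ae_restrict_of_ae ?_)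
        rw [map_smul]
        filter_upwards [Lp.coeFn_smul c (grad u)] with x hx
        rw [hx, Pi.smul_apply, real_inner_smul_left, smul_eq_mul])
      (fun u v v' => by
        rw [← integral_add (integrable_inner_grad u v).restrict
          (integrable_inner_grad u v').restrict]
        refine integral_congr_ae (ae_restrict_of_ae ?_)
        rw [map_add]
        filter_upwards [Lp.coeFn_add (grad v) (grad v')] with x hx
        rw [hx, Pi.add_apply, inner_add_right])
      (fun c u v => by
        rw [← integral_smul]
        refine integral_congr_ae (ae_restrict_of_ae ?_)
        rw [map_smul]
        filter_upwards [Lp.coeFn_smul c (grad v)] with x hx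
        rw [hx, Pi.smul_apply, real_inner_smul_right, smul_eq_mul]))
    1
    (fun u v => by
      rw [one_mul]
      exact norm_integral_inner_grad_le D u v)

/-- The Poincaré variational operator `T_D` on `H^1_0(Ω)`, given by the Riesz theorem:
`∫_Ω ∇(T_D u) · ∇v dx = ∫_D ∇u · ∇v dx` for all `v ∈ H^1_0(Ω)`. -/
noncomputable def poincareOp (Ω : BoundedOpen) (D : Set Plane) :
    SobolevH10 Ω →L[ℝ] SobolevH10 Ω :=
  InnerProductSpace.continuousLinearMapOfBilin (𝕜 := ℝ) (formOn Ω D)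

theorem poincareOp_spec (D : Set Plane) (u v : SobolevH10 Ω) :
    ∫ x in Ω.carrier, inner ℝ (grad (poincareOp Ω D u) x) (grad v x) =
      ∫ x in D, inner ℝ (grad u x) (grad v x) ∂(volOn Ω) :=
  InnerProductSpace.continuousLinearMapOfBilin_apply (𝕜 := ℝ) (formOn Ω D) u v

end SobolevH10

/-- The essential spectrum of a bounded operator `T` on a real Hilbert space: the set of `β` that
admit a singular Weyl sequence, i.e. unit vectors `u n`, converging weakly to `0`, with
`(β I - T) u n → 0` strongly. -/
def essentialSpectrum {E : Type*} [NormedAddCommGroup E] [InnerProductSpace ℝ E]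
    (T : E →L[ℝ] E) : Set ℝ :=
  {β | ∃ u : ℕ → E, (∀ n, ‖u n‖ = 1) ∧
    Tendsto (fun n => β • u n - T (u n)) atTop (𝓝 0) ∧
    ∀ v : E, Tendsto (fun n => inner ℝ (u n) v) atTop (𝓝 0)}

/-- Near its boundary point `p`, the open set `U` is bounded by a smooth curve and lies on one
side of it: it is the sublevel set `{ρ < 0}` of a smooth function with non-vanishing gradient. -/
def SmoothBoundaryAt (U : Set Plane) (p : Plane) : Prop :=
  ∃ (V : Set Plane) (ρ : Plane → ℝ), IsOpen V ∧ p ∈ V ∧ ContDiffOn ℝ ∞ ρ V ∧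
    (∀ x ∈ V, gradient ρ x ≠ 0) ∧ U ∩ V = {x ∈ V | ρ x < 0}

/-- The open plane sector with vertex `0`, opening angle `α`, bisected by the positive first
axis. -/
def sector (α : ℝ) : Set Plane :=
  {x | ∃ r θ : ℝ, 0 < r ∧ |θ| < α / 2 ∧ x = !₂[r * Real.cos θ, r * Real.sin θ]}

/-- `D` is a connected inclusion in `Ω` whose boundary is smooth except for one corner of
angle `α` at the origin, where `D` coincides with a sector. -/
structure IsCornerInclusion (Ω : BoundedOpen) (D : Set Plane) (α : ℝ) : Prop where
  isOpen : IsOpen D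
  isConnected : IsConnected D
  closure_subset : closure D ⊆ Ω.carrier
  angle_pos : 0 < α
  angle_lt : α < Real.pi
  corner : ∃ R₀ : ℝ, 0 < R₀ ∧ D ∩ Metric.ball 0 R₀ = sector α ∩ Metric.ball 0 R₀
  smooth : ∀ p ∈ frontier D, p ≠ 0 → SmoothBoundaryAt D p

/-- `λ₊ = (1/2) (1 - α / π)`. -/
noncomputable def lambdaPlus (α : ℝ) : ℝ := 1 / 2 * (1 - α / Real.pi)

/-- `λ₋ = -λ₊`. -/
noncomputable def lambdaMinus (α : ℝ) : ℝ := -(1 / 2 * (1 - α / Real.pi))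

/-! The operator β - T_D is the weak form of div((β - 1_D)∇u), and the corner makes this problem
invariant under dilations near the origin. In the conformal coordinates s + iθ = log z, dilations
become translations in s. Separation of variables gives bounded solutions cos(ξs)Φ(θ), where Φ'' =
ξ²Φ on each angular interval and both Φ and the flux σΦ' are continuous across the sides of the
sector, with σ = β - 1_D. A nonzero Φ that is even or odd about the bisector exists when (1 - 2β)
sinh(πξ) = ± sinh((π-α)ξ). The quotient of the two sinh falls from 1 - α/π to 0 as ξ runs through
(0, ∞), so every β ≠ 1/2 strictly between α/(2π) and 1 - α/(2π) is reached
(`exists_sinh_eq_mul_sinh`).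

These solutions have infinite energy, but they are generalized eigenfunctions: replace cos(ξs) by a
profile g equal to it times a very long plateau, moved towards s = -∞, so that u = g(s)Φ(θ) lives in
a tiny disc about the corner (`exists_approx_oscillation`). The residual is bounded without second
derivatives of u. With R = σΦ'/ξ, the function ψ = (g'/ξ)R is Lipschitz, its rotated gradient is
orthogonal to all gradients of H^1_0, and σ∇u minus that rotated gradient has only the angular
component (ξg + g''/ξ)R/|z|. By Riesz, ‖βU - T_D U‖ is at most the L² norm of this remainder
(`norm_smul_sub_poincareOp_le`), which is small against ‖∇u‖.

Normalized fields whose gradients concentrate at a point tend weakly to 0, so they form a singular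
Weyl sequence. The two endpoints and β = 1/2 follow because the set of such β is closed. -/

open scoped Convolution

/-! ### Lipschitz functions as elements of H^1_0, by mollification -/

/-- Bounded convergence in `L²` on a finite measure space. -/
theorem tendsto_eLpNorm_two_of_norm_le {X E : Type*} [MeasurableSpace X] [NormedAddCommGroup E]
    {μ : Measure X} [IsFiniteMeasure μ] {f : ℕ → X → E} {g : X → E} {C : ℝ}
    (hf : ∀ n, AEStronglyMeasurable (f n) μ) (hg : AEStronglyMeasurable g μ)
    (hfC : ∀ n x, ‖f n x‖ ≤ C) (hgC : ∀ x, ‖g x‖ ≤ C)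
    (hfg : ∀ᵐ x ∂μ, Tendsto (fun n => f n x) atTop (𝓝 (g x))) :
    Tendsto (fun n => eLpNorm (f n - g) 2 μ) atTop (𝓝 0) := by
  have h2 : Tendsto (fun n => ∫⁻ x, ‖(f n - g) x‖ₑ ^ (2 : ℝ) ∂μ) atTop (𝓝 (∫⁻ _, 0 ∂μ)) := by
    refine tendsto_lintegral_of_dominated_convergence' (fun _ => ENNReal.ofReal (C + C) ^ (2 : ℝ))
      (fun n => (((hf n).sub hg).enorm).pow_const _) (fun n => Eventually.of_forall fun x => ?_)
      ?_ ?_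
    · have : ‖(f n - g) x‖ₑ ≤ ENNReal.ofReal (C + C) := by
        rw [← ofReal_norm]
        exact ENNReal.ofReal_le_ofReal ((norm_sub_le _ _).trans (add_le_add (hfC n x) (hgC x)))
      exact ENNReal.rpow_le_rpow this (by norm_num)
    · rw [lintegral_const]
      exact ENNReal.mul_ne_top (ENNReal.rpow_ne_top_of_nonneg (by norm_num) ENNReal.ofReal_ne_top)
        (measure_ne_top _ _)
    · filter_upwards [hfg] with x hx
      have h3 : Tendsto (fun n => ‖(f n - g) x‖ₑ) atTop (𝓝 0) := by
        have := (hx.sub_const (g x)).enorm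
        simpa using this
      have := h3.ennrpow_const 2
      simpa using this
  have h3 := h2.ennrpow_const (1 / 2)
  simp only [lintegral_zero] at h3
  rw [ENNReal.zero_rpow_of_pos (by norm_num)] at h3
  refine h3.congr fun n => ?_
  rw [eLpNorm_eq_lintegral_rpow_enorm_toReal (by norm_num) (by norm_num)]
  simp

theorem measurable_gradient (u : Plane → ℝ) : Measurable (gradient u) :=
  (InnerProductSpace.toDual ℝ Plane).symm.continuous.measurable.comp (measurable_fderiv ℝ u)

/-- The gradient of a Lipschitz function, mollified, is the gradient of the mollification. -/
theorem gradient_convolution_of_lipschitz {u : Plane → ℝ} {K : NNReal} (hu : LipschitzWith K u)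
    {φ : Plane → ℝ} (hφ : Continuous φ) (hc : HasCompactSupport φ) (x : Plane) :
    gradient (φ ⋆[ContinuousLinearMap.lsmul ℝ ℝ, volume] u) x =
      (φ ⋆[ContinuousLinearMap.lsmul ℝ ℝ, volume] gradient u) x := by
  have hmeas : Measurable (fderiv ℝ u) := measurable_fderiv ℝ u
  have hae : ∀ᵐ t : Plane, DifferentiableAt ℝ u (x - t) := by
    have h := hu.ae_differentiableAt (μ := (volume : Measure Plane))
    exact (quasiMeasurePreserving_sub_left_of_right_invariant volume x).ae h
  -- Differentiation under the integral needs the derivative of `u` only almost everywhere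
  -- (Rademacher), since the Lipschitz bound dominates the difference quotients.
  have key := hasFDerivAt_integral_of_dominated_loc_of_lip (𝕜 := ℝ) (μ := (volume : Measure Plane))
    (F := fun y t => φ t • u (y - t)) (F' := fun t => φ t • fderiv ℝ u (x - t))
    (bound := fun t => ‖φ t‖ * K) (x₀ := x) (s := univ) univ_mem
    (Eventually.of_forall fun y => by
      have := hu.continuous
      exact Continuous.aestronglyMeasurable (by fun_prop))
    (by
      have := hu.continuous
      exact Continuous.integrable_of_hasCompactSupport (by fun_prop) hc.smul_right)
    (by
      refine (hφ.measurable.smul (hmeas.comp (by fun_prop))).aestronglyMeasurable)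
    (Eventually.of_forall fun t => by
      refine LipschitzWith.lipschitzOnWith (LipschitzWith.of_dist_le_mul fun a b => ?_)
      have h1 := hu.dist_le_mul (a - t) (b - t)
      rw [dist_sub_right] at h1
      rw [dist_smul₀, Real.coe_nnabs, abs_of_nonneg (by positivity), mul_assoc]
      gcongr)
    (((hφ.integrable_of_hasCompactSupport hc).norm).mul_const _)
    (by
      filter_upwards [hae] with t ht
      have h1 : HasFDerivAt (fun y => u (y - t)) (fderiv ℝ u (x - t)) x := 
        (hasFDerivAt_comp_sub t).2 ht.hasFDerivAt
      exact h1.const_smul (φ t))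
  have h2 := key.2.fderiv
  have h3 : fderiv ℝ (φ ⋆[ContinuousLinearMap.lsmul ℝ ℝ, volume] u) x =
      ∫ t, φ t • fderiv ℝ u (x - t) := h2
  have hint : Integrable (fun t => φ t • gradient u (x - t)) volume := by
    refine key.1.congr' ?_ (Eventually.of_forall fun t => by simp [gradient, norm_smul])
    exact (hφ.measurable.smul ((measurable_gradient u).comp (by fun_prop))).aestronglyMeasurable
  refine ext_inner_left ℝ fun v => ?_
  rw [real_inner_comm, gradient, InnerProductSpace.toDual_symm_apply, h3,
    ContinuousLinearMap.integral_apply key.1, convolution_def]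
  simp only [ContinuousLinearMap.lsmul_apply]
  rw [← integral_inner hint]
  refine integral_congr_ae (Eventually.of_forall fun t => ?_)
  simp only [inner_smul_right, smul_apply, smul_eq_mul]
  rw [real_inner_comm, gradient, InnerProductSpace.toDual_symm_apply]

theorem norm_gradient_le_of_lipschitz {u : Plane → ℝ} {K : NNReal} (hu : LipschitzWith K u)
    (x : Plane) : ‖gradient u x‖ ≤ K := by
  simpa [gradient] using norm_fderiv_le_of_lipschitz ℝ hu

theorem norm_normed_convolution_le {E : Type*} [NormedAddCommGroup E] [NormedSpace ℝ E]
    (φ : ContDiffBump (0 : Plane)) {g : Plane → E} {C : ℝ} (hg : ∀ x, ‖g x‖ ≤ C) (x : Plane) :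
    ‖(φ.normed volume ⋆[ContinuousLinearMap.lsmul ℝ ℝ, volume] g) x‖ ≤ C := by
  rw [convolution_def]
  refine (norm_integral_le_of_norm_le (g := fun t => φ.normed volume t * C)
    (φ.integrable_normed.mul_const C) (Eventually.of_forall fun t => ?_)).trans ?_
  · rw [ContinuousLinearMap.lsmul_apply, norm_smul, Real.norm_of_nonneg (φ.nonneg_normed t)]
    exact mul_le_mul_of_nonneg_left (hg _) (φ.nonneg_normed t)
  · rw [integral_mul_const, φ.integral_normed, one_mul]

instance (Ω : BoundedOpen) : IsFiniteMeasure (volOn Ω) :=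
  ⟨by rw [Measure.restrict_apply_univ]; exact Ω.isBounded.measure_lt_top⟩

theorem memLp_volOn_of_norm_le {E : Type*} [NormedAddCommGroup E] {Ω : BoundedOpen}
    {f : Plane → E} (hf : AEStronglyMeasurable f volume) {C : ℝ} (hC : ∀ x, ‖f x‖ ≤ C) :
    MemLp f 2 (volOn Ω) :=
  MemLp.of_bound hf.restrict C (Eventually.of_forall hC)

namespace SobolevH10

/-- A Lipschitz function with compact support in `Ω` belongs to `H^1_0(Ω)`. -/
theorem exists_grad_eq_of_lipschitz {Ω : BoundedOpen} {u : Plane → ℝ} {K : NNReal}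
    (hu : LipschitzWith K u) (hc : HasCompactSupport u) (hs : tsupport u ⊆ Ω.carrier) :
    ∃ U : SobolevH10 Ω, grad U =ᵐ[volOn Ω] gradient u := by
  obtain ⟨δ, hδ, hδΩ⟩ := hc.isCompact.exists_cthickening_subset_open Ω.isOpen hs
  obtain ⟨C, hC⟩ := hu.continuous.bounded_above_of_compact_support hc
  -- Outer radii at most δ keep the mollified supports inside `Ω`; the fixed ratio 2 of outer to
  -- inner radius is what the Lebesgue point theorem for bumps requires below.
  let φ : ℕ → ContDiffBump (0 : Plane) := fun n =>
    ⟨δ / (n + 1) / 2, δ / (n + 1), by positivity, half_lt_self (by positivity)⟩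
  have hφ0 : Tendsto (fun n => (φ n).rOut) atTop (𝓝 0) := by
    have := tendsto_one_div_add_atTop_nhds_zero_nat.const_mul δ
    simpa [φ, div_eq_mul_inv] using this
  have hφδ : ∀ n, (φ n).rOut ≤ δ := fun n => by
    change δ / (n + 1) ≤ δ
    exact div_le_self hδ.le (by linarith [Nat.cast_nonneg (α := ℝ) n])
  let w : ℕ → Plane → ℝ := fun n =>
    (φ n).normed volume ⋆[ContinuousLinearMap.lsmul ℝ ℝ, volume] u
  have hgb := norm_gradient_le_of_lipschitz hu
  have hgm : AEStronglyMeasurable (gradient u) volume := (measurable_gradient u).aestronglyMeasurable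
  have hgl : LocallyIntegrable (gradient u) volume :=
    (memLp_top_of_bound hgm K (Eventually.of_forall hgb)).locallyIntegrable le_top
  have hwd : ∀ n, ContDiff ℝ ∞ (w n) := fun n =>
    ((φ n).hasCompactSupport_normed).contDiff_convolution_left _ (n := ⊤) (φ n).contDiff_normed
      hu.continuous.locallyIntegrable
  have hwc : ∀ n, HasCompactSupport (w n) := fun n =>
    ((φ n).hasCompactSupport_normed).convolution _ hc
  have hws : ∀ n, tsupport (w n) ⊆ Ω.carrier := fun n => by
    refine (closure_minimal ?_ Metric.isClosed_cthickening).trans hδΩ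
    refine (support_convolution_subset _).trans ?_
    rintro _ ⟨a, ha, b, hb, rfl⟩
    rw [(φ n).support_normed_eq, mem_ball_zero_iff] at ha
    refine Metric.mem_cthickening_of_dist_le _ b _ _ (subset_tsupport u hb) ?_
    simpa using ha.le.trans (hφδ n)
  have hgw : ∀ n, gradient (w n) =
      (φ n).normed volume ⋆[ContinuousLinearMap.lsmul ℝ ℝ, volume] gradient u := fun n =>
    funext fun x => gradient_convolution_of_lipschitz hu (φ n).continuous_normed
      (φ n).hasCompactSupport_normed x
  have hwC : ∀ n x, ‖w n x‖ ≤ C := fun n => norm_normed_convolution_le (φ n) hC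
  have hgwC : ∀ n x, ‖gradient (w n) x‖ ≤ K := fun n x => by
    rw [hgw]; exact norm_normed_convolution_le (φ n) hgb x
  have hwm : ∀ n, AEStronglyMeasurable (w n) volume := fun n =>
    (hwd n).continuous.aestronglyMeasurable
  have hgwm : ∀ n, AEStronglyMeasurable (gradient (w n)) volume := fun n =>
    (measurable_gradient _).aestronglyMeasurable
  have m1 := fun n => memLp_volOn_of_norm_le (Ω := Ω) (hwm n) (hwC n)
  have m2 := fun n => memLp_volOn_of_norm_le (Ω := Ω) (hgwm n) (hgwC n)
  have m3 := memLp_volOn_of_norm_le (Ω := Ω) hu.continuous.aestronglyMeasurable hC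
  have m4 := memLp_volOn_of_norm_le (Ω := Ω) hgm hgb
  have t1 : Tendsto (fun n => (m1 n).toLp (w n)) atTop (𝓝 (m3.toLp u)) := by
    rw [Lp.tendsto_Lp_iff_tendsto_eLpNorm'']
    refine tendsto_eLpNorm_two_of_norm_le (fun n => (m1 n).1) m3.1 hwC hC
      (Eventually.of_forall fun x => ?_)
    exact ContDiffBump.convolution_tendsto_right_of_continuous hφ0 hu.continuous x
  have t2 : Tendsto (fun n => (m2 n).toLp (gradient (w n))) atTop (𝓝 (m4.toLp (gradient u))) := by
    rw [Lp.tendsto_Lp_iff_tendsto_eLpNorm'']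
    refine tendsto_eLpNorm_two_of_norm_le (fun n => (m2 n).1) m4.1 hgwC hgb (ae_restrict_of_ae ?_)
    simp_rw [hgw]
    refine ContDiffBump.ae_convolution_tendsto_right_of_locallyIntegrable (K := 2) hφ0
      (Eventually.of_forall fun n => ?_) hgl
    change δ / (n + 1) ≤ 2 * (δ / (n + 1) / 2)
    linarith
  have hmem : (m3.toLp u, m4.toLp (gradient u)) ∈ (testGraph Ω).topologicalClosure := by
    refine mem_closure_of_tendsto (t1.prodMk_nhds t2) (Eventually.of_forall fun n => ?_)
    exact ⟨w n, hwd n, hwc n, hws n, (m1 n).coeFn_toLp, (m2 n).coeFn_toLp⟩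
  exact ⟨toPair.symm ⟨_, hmem⟩, m4.coeFn_toLp⟩

end SobolevH10

/-! ### Rotated gradients are divergence free -/

theorem gradient_apply (u : Plane → ℝ) (x : Plane) (i : Fin 2) :
    gradient u x i = fderiv ℝ u x (EuclideanSpace.single i 1) := by
  rw [← InnerProductSpace.toDual_symm_apply (𝕜 := ℝ), EuclideanSpace.inner_single_right]
  simp [gradient]

/-- The rotated gradient `(∂₁ψ, -∂₀ψ)`. -/
noncomputable def rotGradient (ψ : Plane → ℝ) (x : Plane) : Plane :=
  !₂[gradient ψ x 1, -gradient ψ x 0]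

theorem norm_rotGradient (ψ : Plane → ℝ) (x : Plane) : ‖rotGradient ψ x‖ = ‖gradient ψ x‖ := by
  simp [rotGradient, EuclideanSpace.norm_eq, Fin.sum_univ_two, add_comm]

theorem measurable_rotGradient (ψ : Plane → ℝ) : Measurable (rotGradient ψ) := by
  have h : Continuous fun p : Plane => (!₂[p 1, -p 0] : Plane) := by fun_prop
  exact h.measurable.comp (measurable_gradient ψ)

theorem inner_plane (p q : Plane) : inner ℝ p q = p 0 * q 0 + p 1 * q 1 := by
  simp [PiLp.inner_apply, Fin.sum_univ_two, mul_comm]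

/-- Integration by parts for mixed second derivatives. -/
theorem integral_fderiv_mul_fderiv_of_lipschitz {ψ φ : Plane → ℝ} {K : NNReal}
    (hψ : LipschitzWith K ψ) (hφ : ContDiff ℝ ∞ φ) (hc : HasCompactSupport φ) (v w : Plane) :
    ∫ x, fderiv ℝ ψ x v * fderiv ℝ φ x w = -∫ x, fderiv ℝ (fderiv ℝ φ) x v w * ψ x := by
  have hd : ContDiff ℝ ∞ (fderiv ℝ φ) := hφ.fderiv_right (by simp)
  have hg : ContDiff ℝ ∞ (fun x => fderiv ℝ φ x w) := hd.clm_apply contDiff_const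
  have hgc : HasCompactSupport (fun x => fderiv ℝ φ x w) := hc.fderiv_apply ℝ w
  obtain ⟨C, hC⟩ := hg.lipschitzWith_of_hasCompactSupport hgc (by simp)
  have h := LipschitzWith.integral_lineDeriv_mul_eq (μ := (volume : Measure Plane)) hψ hC hgc v
  rw [← integral_neg]
  refine Eq.trans ?_ (h.trans ?_)
  · refine integral_congr_ae ?_
    filter_upwards [hψ.ae_differentiableAt (μ := (volume : Measure Plane))] with x hx
    rw [hx.lineDeriv_eq_fderiv]
  · refine integral_congr_ae (Eventually.of_forall fun x => ?_)
    have h1 : DifferentiableAt ℝ (fderiv ℝ φ) x := hd.differentiable (by simp) x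
    simp only
    rw [(hg.differentiable (by simp) x).lineDeriv_eq_fderiv,
      fderiv_clm_apply h1 (differentiableAt_const w)]
    simp

/-- Rotated gradients of Lipschitz functions are divergence free. -/
theorem integral_inner_rotGradient_gradient {ψ φ : Plane → ℝ} {K : NNReal}
    (hψ : LipschitzWith K ψ) (hφ : ContDiff ℝ ∞ φ) (hc : HasCompactSupport φ) :
    ∫ x, inner ℝ (rotGradient ψ x) (gradient φ x) = 0 := by
  set e : Fin 2 → Plane := fun i => EuclideanSpace.single i 1 with he
  have hint : ∀ v w : Plane, Integrable (fun x => fderiv ℝ ψ x v * fderiv ℝ φ x w) := by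
    intro v w
    have hg : Continuous (fun x => fderiv ℝ φ x w) :=
      (hφ.continuous_fderiv (by simp)).clm_apply continuous_const
    refine (hg.integrable_of_hasCompactSupport (hc.fderiv_apply ℝ w)).bdd_mul (c := K * ‖v‖)
      ((measurable_fderiv_apply_const ℝ ψ v).aestronglyMeasurable)
      (Eventually.of_forall fun x => ?_)
    exact (ContinuousLinearMap.le_opNorm _ _).trans
      (mul_le_mul_of_nonneg_right (norm_fderiv_le_of_lipschitz ℝ hψ) (norm_nonneg v))
  have h1 : ∀ x, inner ℝ (rotGradient ψ x) (gradient φ x) =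
      fderiv ℝ ψ x (e 1) * fderiv ℝ φ x (e 0) - fderiv ℝ ψ x (e 0) * fderiv ℝ φ x (e 1) := by
    intro x
    rw [inner_plane]
    simp only [rotGradient, gradient_apply, he]
    simp
    ring
  simp_rw [h1]
  rw [integral_sub (hint _ _) (hint _ _), integral_fderiv_mul_fderiv_of_lipschitz hψ hφ hc,
    integral_fderiv_mul_fderiv_of_lipschitz hψ hφ hc, sub_eq_zero]
  congr 1
  refine integral_congr_ae (Eventually.of_forall fun x => ?_)
  -- Both derivatives now fall on the smooth factor, where mixed partials commute.
  have hs : IsSymmSndFDerivAt ℝ φ x := hφ.contDiffAt.isSymmSndFDerivAt (by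
    simpa using (WithTop.coe_le_coe.2 le_top : ((2 : ℕ∞) : WithTop ℕ∞) ≤ ∞))
  simp only
  rw [hs.eq]

/-! ### The residual estimate -/

namespace SobolevH10

variable {Ω : BoundedOpen}

theorem memLp_rotGradient {ψ : Plane → ℝ} {K : NNReal} (hψ : LipschitzWith K ψ) :
    MemLp (rotGradient ψ) 2 (volOn Ω) :=
  memLp_volOn_of_norm_le (measurable_rotGradient ψ).aestronglyMeasurable (C := K) fun x =>
    (norm_rotGradient ψ x).trans_le (norm_gradient_le_of_lipschitz hψ x)

/-- Orthogonality holds for test functions and is a closed condition, so it passes to the closure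
that defines H^1_0. No boundary condition on `ψ` is needed, since the test functions have compact
support in `Ω`. -/
theorem inner_rotGradient_grad {ψ : Plane → ℝ} {K : NNReal} (hψ : LipschitzWith K ψ)
    (v : SobolevH10 Ω) : inner ℝ ((memLp_rotGradient (Ω := Ω) hψ).toLp _) (grad v) = 0 := by
  have hcl : IsClosed {p : Lp ℝ 2 (volOn Ω) × Lp Plane 2 (volOn Ω) |
      inner ℝ ((memLp_rotGradient (Ω := Ω) hψ).toLp _) p.2 = 0} :=
    isClosed_eq (by fun_prop) continuous_const
  refine closure_minimal ?_ hcl (toPair v).2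
  rintro p ⟨φ, h1, h2, h3, h4, h5⟩
  rw [mem_ofPred_eq, L2.inner_def, ← integral_inner_rotGradient_gradient hψ h1 h2]
  have hs : ∀ x ∉ Ω.carrier, inner ℝ (rotGradient ψ x) (gradient φ x) = 0 := fun x hx => by
    have : fderiv ℝ φ x = 0 := by
      by_contra h
      exact hx (h3 (support_fderiv_subset ℝ h))
    simp [gradient, this]
  rw [← setIntegral_eq_integral_of_forall_compl_eq_zero hs]
  refine integral_congr_ae ?_
  filter_upwards [(memLp_rotGradient (Ω := Ω) hψ).coeFn_toLp, h5] with x hx1 hx2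
  rw [hx1, hx2]

/-- If `(β - 1_D) ∇U` is a field `F` up to a rotated gradient, then `‖β U - T_D U‖ ≤ ‖F‖`. -/
theorem norm_smul_sub_poincareOp_le {D : Set Plane} (hD : MeasurableSet D) {β : ℝ}
    {U : SobolevH10 Ω} {F : Plane → Plane} (hF : MemLp F 2 (volOn Ω)) {ψ : Plane → ℝ} {K : NNReal}
    (hψ : LipschitzWith K ψ)
    (h : ∀ᵐ x ∂volOn Ω, β • grad U x - D.indicator (grad U) x = rotGradient ψ x + F x) :
    ‖β • U - poincareOp Ω D U‖ ≤ ‖hF.toLp F‖ := by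
  set w := β • U - poincareOp Ω D U with hw
  -- Test the defining identity of T_D with the residual itself; the rotated gradient drops out.
  have e1 : inner ℝ w w = inner ℝ (hF.toLp F) (grad w) := by
    conv_lhs => rw [hw]
    rw [inner_sub_left, real_inner_smul_left, inner_eq, inner_eq, poincareOp_spec,
      ← integral_indicator hD, ← integral_const_mul, ← integral_sub
        ((integrable_inner_grad U w).const_mul β) ((integrable_inner_grad U w).indicator hD)]
    rw [← zero_add (inner ℝ (hF.toLp F) (grad w)), ← inner_rotGradient_grad (Ω := Ω) hψ w,
      ← inner_add_left, L2.inner_def]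
    refine integral_congr_ae ?_
    filter_upwards [h, Lp.coeFn_add ((memLp_rotGradient (Ω := Ω) hψ).toLp _) (hF.toLp F),
      (memLp_rotGradient (Ω := Ω) hψ).coeFn_toLp, hF.coeFn_toLp] with x h1 h2 h3 h4
    rw [h2, Pi.add_apply, h3, h4, ← h1, inner_sub_left, real_inner_smul_left]
    by_cases hx : x ∈ D <;> simp [hx]
  have e2 : ‖w‖ * ‖w‖ ≤ ‖hF.toLp F‖ * ‖w‖ := by
    rw [← real_inner_self_eq_norm_mul_norm, e1, norm_eq w]
    exact real_inner_le_norm _ _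
  rcases (norm_nonneg w).eq_or_lt with h0 | h0
  · rw [← h0]; exact norm_nonneg _
  · exact le_of_mul_le_mul_right e2 h0

/-! ### Approximate eigenvectors concentrating at the corner -/

/-- `β` is an approximate eigenvalue of `T_D` with approximate eigenvectors whose gradients are
concentrated arbitrarily close to the origin. -/
def IsApproxEigenvalueAtZero (Ω : BoundedOpen) (D : Set Plane) (β : ℝ) : Prop :=
  ∀ ε > 0, ∃ U : SobolevH10 Ω, ‖U‖ = 1 ∧ ‖β • U - poincareOp Ω D U‖ ≤ ε ∧
    ∀ᵐ x ∂volOn Ω, ε ≤ ‖x‖ → grad U x = 0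

/-- On a unit vector, changing β moves the residual by at most the change in β, so a vector that is
good for a nearby value is reused with half the tolerance. -/
theorem isClosed_isApproxEigenvalueAtZero (Ω : BoundedOpen) (D : Set Plane) :
    IsClosed {β | IsApproxEigenvalueAtZero Ω D β} := by
  refine isClosed_of_closure_subset fun β hβ ε hε => ?_
  obtain ⟨β', h', hd⟩ := Metric.mem_closure_iff.1 hβ (ε / 2) (half_pos hε)
  obtain ⟨U, h1, h2, h3⟩ := h' (ε / 2) (half_pos hε)
  refine ⟨U, h1, ?_, h3.mono fun x hx hx' => hx (by linarith)⟩
  calc ‖β • U - poincareOp Ω D U‖ = ‖(β - β') • U + (β' • U - poincareOp Ω D U)‖ := by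
        rw [sub_smul]; abel_nf
    _ ≤ ‖(β - β') • U‖ + ‖β' • U - poincareOp Ω D U‖ := norm_add_le _ _
    _ ≤ ε / 2 + ε / 2 := by
        rw [norm_smul, h1, mul_one, ← dist_eq_norm]
        exact add_le_add hd.le h2
    _ = ε := add_halves ε

/-- Concentration forces weak convergence: ⟨U n, v⟩ sees ∇v only on a shrinking disc, and the L²
norm of ∇v there tends to 0 by dominated convergence, a single point being null. -/
theorem IsApproxEigenvalueAtZero.mem_essentialSpectrum {D : Set Plane} {β : ℝ}
    (h : IsApproxEigenvalueAtZero Ω D β) : β ∈ essentialSpectrum (poincareOp Ω D) := by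
  choose U h1 h2 h3 using fun n : ℕ => h (1 / ((n : ℝ) + 1)) Nat.one_div_pos_of_nat
  have h0 := tendsto_one_div_add_atTop_nhds_zero_nat (𝕜 := ℝ)
  refine ⟨U, h1, squeeze_zero_norm h2 h0, fun v => ?_⟩
  have hv : Integrable (fun x => ‖grad v x‖ ^ 2) (volOn Ω) :=
    (memLp_two_iff_integrable_sq_norm (Lp.aestronglyMeasurable _)).1 (Lp.memLp (grad v))
  let S : ℕ → Set Plane := fun n => Metric.ball 0 (1 / ((n : ℝ) + 1))
  have hS : ∀ n, MeasurableSet (S n) := fun n => Metric.isOpen_ball.measurableSet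
  have hI : ∀ n, MemLp ((S n).indicator (grad v)) 2 (volOn Ω) := fun n =>
    MemLp.indicator (hS n) (Lp.memLp (grad v))
  let V : ℕ → Lp Plane 2 (volOn Ω) := fun n => (hI n).toLp _
  have hV : ∀ n, inner ℝ (U n) v = inner ℝ (grad (U n)) (V n) := fun n => by
    rw [inner_eq, L2.inner_def]
    refine integral_congr_ae ?_
    filter_upwards [h3 n, (hI n).coeFn_toLp] with x hx1 hx2
    rw [hx2]
    by_cases hx : x ∈ S n
    · simp [hx]
    · rw [hx1 (by simpa [S] using hx)]
      simp
  have hV0 : Tendsto (fun n => ‖V n‖) atTop (𝓝 0) := by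
    have hsq : Tendsto (fun n => ‖V n‖ ^ 2) atTop (𝓝 (∫ _, (0 : ℝ) ∂volOn Ω)) := by
      have : ∀ n, ‖V n‖ ^ 2 = ∫ x, (S n).indicator (fun x => ‖grad v x‖ ^ 2) x ∂volOn Ω := by
        intro n
        rw [← real_inner_self_eq_norm_sq, L2.inner_def]
        refine integral_congr_ae ?_
        filter_upwards [(hI n).coeFn_toLp] with x hx2
        rw [hx2, real_inner_self_eq_norm_sq]
        by_cases hx : x ∈ S n <;> simp [hx]
      simp_rw [this]
      refine tendsto_integral_of_dominated_convergence (fun x => ‖grad v x‖ ^ 2)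
        (fun n => hv.1.indicator (hS n)) hv
        (fun n => Eventually.of_forall fun x => ?_) ?_
      · refine (norm_indicator_le_norm_self _ _).trans_eq ?_
        simp
      · have hne : ∀ᵐ x ∂volOn Ω, x ≠ 0 :=
          ae_restrict_of_ae (Measure.ae_ne volume 0)
        filter_upwards [hne] with x hx
        refine tendsto_const_nhds.congr' ?_
        filter_upwards [h0.eventually (gt_mem_nhds (norm_pos_iff.2 hx))] with n hn
        rw [indicator_of_notMem]
        simpa [S] using hn.le
    rw [integral_zero] at hsq
    have := hsq.sqrt
    simpa [Real.sqrt_sq] using this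
  refine squeeze_zero_norm (fun n => ?_) hV0
  rw [hV]
  refine (norm_inner_le_norm _ _).trans_eq ?_
  rw [← norm_eq, h1, one_mul]

end SobolevH10

/-! ### Gluing and localizing Lipschitz functions -/

theorem exists_mem_segment_inter_frontier {E : Type*} [NormedAddCommGroup E] [NormedSpace ℝ E]
    {S : Set E} (hS : IsOpen S) {x y : E} (hx : x ∈ S) (hy : y ∉ S) :
    ∃ w ∈ segment ℝ x y, w ∈ frontier S := by
  by_contra! h
  have h1 : segment ℝ x y ⊆ S := by
    refine (convex_segment x y).isPreconnected.subset_left_of_subset_union hS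
      isClosed_closure.isOpen_compl (disjoint_compl_right.mono_left subset_closure |>.mono_right
        le_rfl) (fun w hw => ?_) ⟨x, left_mem_segment ℝ x y, hx⟩
    by_contra hc
    rw [mem_union, not_or, mem_compl_iff, not_not] at hc
    refine h w hw ?_
    rw [hS.frontier_eq]
    exact ⟨hc.2, hc.1⟩
  exact hy (h1 (right_mem_segment ℝ x y))

open Classical in
/-- Gluing Lipschitz functions along the frontier of an open set. -/
theorem LipschitzOnWith.piecewise_of_eqOn_frontier {E F : Type*} [NormedAddCommGroup E]
    [NormedSpace ℝ E] [PseudoMetricSpace F] {S B : Set E} (hS : IsOpen S) (hB : Convex ℝ B)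
    {f g : E → F} {K : NNReal} (hf : LipschitzOnWith K f B) (hg : LipschitzOnWith K g B)
    (hfg : ∀ x ∈ B, x ∈ frontier S → f x = g x) : LipschitzOnWith K (S.piecewise f g) B := by
  -- Pass through a frontier point on the segment; distances add along it, so the constant `K` is
  -- not lost.
  have key : ∀ x ∈ B, ∀ y ∈ B, x ∈ S → y ∉ S → dist (f x) (g y) ≤ K * dist x y := by
    intro x hx y hy hxS hyS
    obtain ⟨w, hw, hwS⟩ := exists_mem_segment_inter_frontier hS hxS hyS
    have hwB := hB.segment_subset hx hy hw
    calc dist (f x) (g y) ≤ dist (f x) (f w) + dist (g w) (g y) := by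
          rw [← hfg w hwB hwS]; exact dist_triangle _ _ _
      _ ≤ K * dist x w + K * dist w y :=
          add_le_add (hf.dist_le_mul x hx w hwB) (hg.dist_le_mul w hwB y hy)
      _ = K * dist x y := by rw [← mul_add, dist_add_dist_of_mem_segment hw]
  refine LipschitzOnWith.of_dist_le_mul fun x hx y hy => ?_
  by_cases hxS : x ∈ S <;> by_cases hyS : y ∈ S
  · simpa [hxS, hyS] using hf.dist_le_mul x hx y hy
  · simpa [hxS, hyS] using key x hx y hy hxS hyS
  · simpa [hxS, hyS, dist_comm] using key y hy x hx hyS hxS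
  · simpa [hxS, hyS] using hg.dist_le_mul x hx y hy

/-- A locally Lipschitz function with compact support is Lipschitz. -/
theorem LocallyLipschitz.exists_lipschitzWith_of_hasCompactSupport {E : Type*}
    [NormedAddCommGroup E] [NormedSpace ℝ E] [FiniteDimensional ℝ E] {f : E → ℝ}
    (hf : LocallyLipschitz f) (hc : HasCompactSupport f) : ∃ K, LipschitzWith K f := by
  have : ProperSpace E := FiniteDimensional.proper ℝ E
  obtain ⟨R, hR⟩ := hc.isCompact.isBounded.subset_ball (0 : E)
  obtain ⟨K, hK⟩ := (hf.locallyLipschitzOn (s := Metric.closedBall 0 (R + 1))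
    ).exists_lipschitzOnWith_of_compact (isCompact_closedBall _ _)
  obtain ⟨C, hC⟩ := hf.continuous.bounded_above_of_compact_support hc
  have hC0 : 0 ≤ C := (norm_nonneg _).trans (hC 0)
  have hz : ∀ y, y ∉ Metric.closedBall (0 : E) (R + 1) → f y = 0 := fun y hy =>
    image_eq_zero_of_notMem_tsupport fun h => hy
      (Metric.ball_subset_closedBall (Metric.ball_subset_ball (by linarith) (hR h)))
  -- The collar of width 1 separates `y` from the support, so the sup bound `C` serves as a
  -- Lipschitz constant.
  have key : ∀ x y, y ∉ Metric.closedBall (0 : E) (R + 1) → dist (f x) (f y) ≤ C * dist x y := by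
    intro x y hy
    rw [hz y hy, dist_zero_right]
    by_cases hx : x ∈ tsupport f
    · have h1 := hR hx
      rw [mem_ball_zero_iff] at h1
      rw [mem_closedBall_zero_iff, not_le] at hy
      have h2 : 1 ≤ dist x y := by
        rw [dist_comm, dist_eq_norm]
        linarith [norm_sub_norm_le y x]
      nlinarith [hC x]
    · rw [image_eq_zero_of_notMem_tsupport hx, norm_zero]
      positivity
  refine ⟨K + C.toNNReal, LipschitzWith.of_dist_le_mul fun x y => ?_⟩
  rw [NNReal.coe_add, Real.coe_toNNReal C hC0, add_mul]
  have hp1 : 0 ≤ (K : ℝ) * dist x y := by positivity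
  have hp2 : 0 ≤ C * dist x y := by positivity
  by_cases hx : x ∈ Metric.closedBall (0 : E) (R + 1)
  · by_cases hy : y ∈ Metric.closedBall (0 : E) (R + 1)
    · linarith [hK.dist_le_mul x hx y hy]
    · linarith [key x y hy]
  · have := key y x hx
    rw [dist_comm, dist_comm y x] at this
    linarith

/-! ### The sector and piecewise log-polar functions -/

/-- The open sector `|arg z| < α / 2` in the complex plane (for `0 < α ≤ 2π`). -/
def complexSector (α : ℝ) : Set ℂ := {z | Real.cos (α / 2) * ‖z‖ < z.re}

theorem isOpen_complexSector (α : ℝ) : IsOpen (complexSector α) :=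
  isOpen_lt (by fun_prop) Complex.continuous_re

/-- Since α < π makes cos(α/2) nonnegative, the sector is a strict sublevel set of a convex
function. Convexity is used later to see that its frontier is null. -/
theorem convex_complexSector {α : ℝ} (h0 : 0 < α) (h1 : α < Real.pi) :
    Convex ℝ (complexSector α) := by
  have hc : 0 ≤ Real.cos (α / 2) := Real.cos_nonneg_of_mem_Icc ⟨by linarith, by linarith⟩
  have h : ConvexOn ℝ univ fun z : ℂ => Real.cos (α / 2) * ‖z‖ - z.re :=
    ((convexOn_univ_norm (E := ℂ)).smul hc).sub
      (Complex.reLm.concaveOn convex_univ)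
  have he : complexSector α = {z ∈ univ | Real.cos (α / 2) * ‖z‖ - z.re < 0} :=
    Set.ext fun z => ⟨fun h => ⟨trivial, sub_neg.2 h⟩, fun h => sub_neg.1 h.2⟩
  rw [he]
  exact h.convex_lt 0

theorem re_eq_cos_arg (z : ℂ) : z.re = Real.cos (Complex.arg z) * ‖z‖ := by
  rw [mul_comm, Complex.norm_mul_cos_arg]

theorem mem_complexSector_iff {α : ℝ} (h0 : 0 < α) (h1 : α < Real.pi) {z : ℂ} (hz : z ≠ 0) :
    z ∈ complexSector α ↔ |Complex.arg z| < α / 2 := by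
  rw [complexSector, mem_ofPred_eq, re_eq_cos_arg, mul_lt_mul_iff_left₀ (norm_pos_iff.2 hz),
    ← Real.cos_abs (Complex.arg z)]
  exact Real.strictAntiOn_cos.lt_iff_gt ⟨by linarith, by linarith⟩
    ⟨abs_nonneg _, Complex.abs_arg_le_pi z⟩

theorem abs_arg_of_mem_frontier {α : ℝ} (h0 : 0 < α) (h1 : α < Real.pi) {z : ℂ} (hz : z ≠ 0)
    (h : z ∈ frontier (complexSector α)) : |Complex.arg z| = α / 2 := by
  have h2 : Real.cos (α / 2) * ‖z‖ = z.re :=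
    frontier_lt_subset_eq (by fun_prop) Complex.continuous_re h
  rw [re_eq_cos_arg] at h2
  have h3 := mul_right_cancel₀ (norm_ne_zero_iff.2 hz) h2
  rw [← Real.cos_abs (Complex.arg z)] at h3
  exact (Real.injOn_cos ⟨by linarith, by linarith⟩ ⟨abs_nonneg _, Complex.abs_arg_le_pi z⟩ h3).symm

theorem mem_slitPlane_of_mem_complexSector {α : ℝ} (h0 : 0 < α) (h1 : α < Real.pi) {z : ℂ}
    (h : z ∈ complexSector α) : z ∈ Complex.slitPlane := by
  have hc : 0 ≤ Real.cos (α / 2) := Real.cos_nonneg_of_mem_Icc ⟨by linarith, by linarith⟩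
  exact Or.inl (lt_of_le_of_lt (by positivity) h)

/-- This is why arg(-z) is the angle used outside the sector: its branch cut is the positive real
axis, which lies inside the sector apart from the vertex. -/
theorem neg_mem_slitPlane_of_notMem_complexSector {α : ℝ} (h0 : 0 < α) (h1 : α < Real.pi) {z : ℂ}
    (hz : z ≠ 0) (h : z ∉ complexSector α) : -z ∈ Complex.slitPlane := by
  by_contra hn
  rw [Complex.slitPlane, mem_ofPred_eq, not_or, Complex.neg_re, Complex.neg_im, not_lt, not_not,
    neg_eq_zero] at hn
  have ha : Complex.arg z = 0 := Complex.arg_eq_zero_iff.2 ⟨by linarith [hn.1], hn.2⟩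
  refine h ((mem_complexSector_iff h0 h1 hz).2 ?_)
  rw [ha, abs_zero]; linarith

/-- A function in polar coordinates. -/
noncomputable def logPolar (k P : ℝ → ℝ) (z : ℂ) : ℝ := k (Complex.log z).re * P (Complex.log z).im

theorem contDiffAt_logPolar {k P : ℝ → ℝ} (hk : ContDiff ℝ 1 k) (hP : ContDiff ℝ 1 P) {z : ℂ}
    (hz : z ∈ Complex.slitPlane) : ContDiffAt ℝ 1 (logPolar k P) z := by
  have hl : ContDiffAt ℝ 1 Complex.log z := (Complex.contDiffAt_log hz).restrict_scalars ℝ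
  have hre : ContDiffAt ℝ 1 (fun z => (Complex.log z).re) z :=
    Complex.reCLM.contDiff.contDiffAt.comp z hl
  have him : ContDiffAt ℝ 1 (fun z => (Complex.log z).im) z :=
    Complex.imCLM.contDiff.contDiffAt.comp z hl
  exact (hk.contDiffAt.comp z hre).mul (hP.contDiffAt.comp z him)

/-- The covector `p ds + q dθ`, where `s + iθ = log z`. -/
noncomputable def logPolarCovector (z : ℂ) (p q : ℝ) : ℂ →L[ℝ] ℝ :=
  p • Complex.reCLM ∘L (ContinuousLinearMap.mul ℝ ℂ z⁻¹) +
    q • Complex.imCLM ∘L (ContinuousLinearMap.mul ℝ ℂ z⁻¹)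

theorem logPolarCovector_apply (z : ℂ) (p q : ℝ) (h : ℂ) :
    logPolarCovector z p q h = p * (z⁻¹ * h).re + q * (z⁻¹ * h).im := rfl

theorem hasFDerivAt_logPolar {k P : ℝ → ℝ} {k' P' : ℝ} {z : ℂ} (hz : z ∈ Complex.slitPlane)
    (hk : HasDerivAt k k' (Complex.log z).re) (hP : HasDerivAt P P' (Complex.log z).im) :
    HasFDerivAt (logPolar k P) (logPolarCovector z (k' * P (Complex.log z).im)
      (k (Complex.log z).re * P')) z := by
  have hl : HasFDerivAt Complex.log (ContinuousLinearMap.mul ℝ ℂ z⁻¹) z := by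
    have := (Complex.hasStrictDerivAt_log hz).hasDerivAt.hasFDerivAt.restrictScalars ℝ
    refine this.congr_fderiv ?_
    ext h
    simp [mul_comm]
  have hre := hk.comp_hasFDerivAt z (Complex.reCLM.hasFDerivAt.comp z hl)
  have him := hP.comp_hasFDerivAt z (Complex.imCLM.hasFDerivAt.comp z hl)
  refine (hre.mul him).congr_fderiv ?_
  ext h
  all_goals
    simp [logPolarCovector]
    ring

open Classical in
/-- The function equal to `P (arg z)` in the sector and to `Q (arg (-z))` outside. -/
noncomputable def angular (α : ℝ) (P Q : ℝ → ℝ) : ℂ → ℝ :=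
  (complexSector α).piecewise (fun z => P (Complex.arg z)) (fun z => Q (Complex.arg (-z)))

/-- A function in polar coordinates, with different angular parts in the sector and outside. -/
noncomputable def sectorPolar (α : ℝ) (k P Q : ℝ → ℝ) (z : ℂ) : ℝ :=
  k (Real.log ‖z‖) * angular α P Q z

theorem sectorPolar_of_mem {α : ℝ} {k P Q : ℝ → ℝ} {z : ℂ} (h : z ∈ complexSector α) :
    sectorPolar α k P Q z = logPolar k P z := by
  simp [sectorPolar, angular, h, logPolar, Complex.log_re, Complex.log_im]

theorem sectorPolar_of_notMem {α : ℝ} {k P Q : ℝ → ℝ} {z : ℂ} (h : z ∉ complexSector α) :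
    sectorPolar α k P Q z = logPolar k Q (-z) := by
  simp [sectorPolar, angular, h, logPolar, Complex.log_re, Complex.log_im]

open Classical in
theorem sectorPolar_eq_piecewise (α : ℝ) (k P Q : ℝ → ℝ) : sectorPolar α k P Q =
    (complexSector α).piecewise (logPolar k P) (fun z => logPolar k Q (-z)) := by
  ext z
  by_cases h : z ∈ complexSector α
  · simp [h, sectorPolar_of_mem]
  · simp [h, sectorPolar_of_notMem]

/-- Outside the sector the signs from (-z)⁻¹ and from the derivative of z ↦ -z cancel, so one
covector formula serves both regions. -/
theorem hasFDerivAt_sectorPolar {α : ℝ} (h0 : 0 < α) (h1 : α < Real.pi)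
    {k k' P P' Q Q' : ℝ → ℝ} (hk : ∀ s, HasDerivAt k (k' s) s) (hP : ∀ s, HasDerivAt P (P' s) s)
    (hQ : ∀ s, HasDerivAt Q (Q' s) s) {z : ℂ} (hz : z ≠ 0)
    (hf : z ∉ frontier (complexSector α)) :
    HasFDerivAt (sectorPolar α k P Q)
      (logPolarCovector z (sectorPolar α k' P Q z) (sectorPolar α k P' Q' z)) z := by
  by_cases h : z ∈ complexSector α
  · have hd := hasFDerivAt_logPolar (mem_slitPlane_of_mem_complexSector h0 h1 h) (hk _) (hP _)
    rw [sectorPolar_of_mem h, sectorPolar_of_mem h]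
    refine hd.congr_of_eventuallyEq ?_
    filter_upwards [(isOpen_complexSector α).mem_nhds h] with w hw using sectorPolar_of_mem hw
  · have hz' := neg_mem_slitPlane_of_notMem_complexSector h0 h1 hz h
    have hd := (hasFDerivAt_logPolar hz' (hk _) (hQ _)).comp z (hasFDerivAt_id z).neg
    have hc : z ∈ (closure (complexSector α))ᶜ := by
      intro hc
      rw [(isOpen_complexSector α).frontier_eq] at hf
      exact hf ⟨hc, h⟩
    rw [sectorPolar_of_notMem h, sectorPolar_of_notMem h]
    refine (hd.congr_of_eventuallyEq ?_).congr_fderiv ?_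
    · filter_upwards [isClosed_closure.isOpen_compl.mem_nhds hc] with w hw
      exact sectorPolar_of_notMem fun hw' => hw (subset_closure hw')
    · ext h
      all_goals
        simp [logPolarCovector_apply, logPolar, inv_neg]
        ring

theorem sectorPolar_eq_zero {α a b : ℝ} {k P Q : ℝ → ℝ} (hk : ∀ s, s ∉ Icc a b → k s = 0)
    (hb : b < 0) {z : ℂ} (hz : z ∉ Metric.closedBall 0 (Real.exp b) \ Metric.ball 0 (Real.exp a)) :
    sectorPolar α k P Q z = 0 := by
  rw [sectorPolar, hk, zero_mul]
  rintro ⟨h1, h2⟩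
  -- Since `Real.log 0 = 0`, the value at the origin involves `k 0`; the condition b < 0 keeps 0
  -- outside `Icc a b`.
  rcases eq_or_ne z 0 with rfl | h0
  · simp at h2; linarith
  · have hp := norm_pos_iff.2 h0
    rw [Real.le_log_iff_exp_le hp] at h1
    rw [Real.log_le_iff_le_exp hp] at h2
    exact hz ⟨by simpa using h2, by simpa using h1⟩

theorem arg_neg_of_arg_eq {z : ℂ} {t : ℝ} (h0 : 0 < t) (h1 : t < Real.pi)
    (h : Complex.arg z = t) : Complex.arg (-z) = t - Real.pi := by
  rw [Complex.arg_neg_eq_arg_sub_pi_of_im_pos, h]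
  have hz : z ≠ 0 := by rintro rfl; simp at h; linarith
  rw [← Complex.norm_mul_sin_arg, h]
  exact mul_pos (norm_pos_iff.2 hz) (Real.sin_pos_of_pos_of_lt_pi h0 h1)

theorem arg_neg_of_arg_eq_neg {z : ℂ} {t : ℝ} (h0 : 0 < t) (h1 : t < Real.pi)
    (h : Complex.arg z = -t) : Complex.arg (-z) = Real.pi - t := by
  rw [Complex.arg_neg_eq_arg_add_pi_of_im_neg, h]
  · ring
  have hz : z ≠ 0 := by rintro rfl; simp at h; linarith
  rw [← Complex.norm_mul_sin_arg, h, Real.sin_neg]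
  have := mul_pos (norm_pos_iff.2 hz) (Real.sin_pos_of_pos_of_lt_pi h0 h1)
  linarith

/-- Locally the function vanishes (near 0), is C¹ (off the sides), or is glued from two branches
that are C¹ on both sides of the ray. The matching conditions say that the branches agree there,
since arg(-z) = arg z ∓ π on the upper and lower side. -/
theorem exists_lipschitzWith_sectorPolar {α a b : ℝ} (h0 : 0 < α) (h1 : α < Real.pi)
    {k P Q : ℝ → ℝ} (hk : ContDiff ℝ 1 k) (hP : ContDiff ℝ 1 P) (hQ : ContDiff ℝ 1 Q)
    (hks : ∀ s, s ∉ Icc a b → k s = 0) (hb : b < 0)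
    (hPQ : P (α / 2) = Q (α / 2 - Real.pi)) (hPQ' : P (-(α / 2)) = Q (Real.pi - α / 2)) :
    ∃ K, LipschitzWith K (sectorPolar α k P Q) := by
  classical
  have hc : HasCompactSupport (sectorPolar α k P Q) :=
    HasCompactSupport.intro (isCompact_closedBall (0 : ℂ) (Real.exp b)) fun z hz =>
      sectorPolar_eq_zero hks hb fun h => hz h.1
  refine LocallyLipschitz.exists_lipschitzWith_of_hasCompactSupport (fun z => ?_) hc
  rcases eq_or_ne z 0 with rfl | hz
  · refine ⟨0, Metric.ball 0 (Real.exp a), Metric.ball_mem_nhds _ (Real.exp_pos a), ?_⟩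
    intro x hx y hy
    rw [sectorPolar_eq_zero hks hb fun h => h.2 hx, sectorPolar_eq_zero hks hb fun h => h.2 hy]
    simp
  by_cases hf : z ∈ frontier (complexSector α)
  · have hzS : z ∉ complexSector α := by
      rw [(isOpen_complexSector α).frontier_eq] at hf
      exact hf.2
    have harg := abs_arg_of_mem_frontier h0 h1 hz hf
    have hs : z ∈ Complex.slitPlane := by
      rw [Complex.mem_slitPlane_iff_arg]
      refine ⟨fun h => ?_, hz⟩
      rw [h, abs_of_pos Real.pi_pos] at harg
      linarith
    have hs' := neg_mem_slitPlane_of_notMem_complexSector h0 h1 hz hzS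
    obtain ⟨K₁, t₁, ht₁, hK₁⟩ := (contDiffAt_logPolar hk hP hs).exists_lipschitzOnWith
    have hd : ContDiffAt ℝ 1 (fun z => logPolar k Q (-z)) z :=
      (contDiffAt_logPolar hk hQ hs').comp z contDiff_neg.contDiffAt
    obtain ⟨K₂, t₂, ht₂, hK₂⟩ := hd.exists_lipschitzOnWith
    obtain ⟨r, hr, hrt⟩ := Metric.mem_nhds_iff.1
      (inter_mem (inter_mem ht₁ ht₂) (isOpen_ne.mem_nhds hz))
    refine ⟨max K₁ K₂, Metric.ball z r, Metric.ball_mem_nhds z hr, ?_⟩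
    rw [sectorPolar_eq_piecewise]
    refine LipschitzOnWith.piecewise_of_eqOn_frontier (isOpen_complexSector α)
      (convex_ball z r) ((hK₁.mono fun w hw => (hrt hw).1.1).weaken (le_max_left _ _))
      ((hK₂.mono fun w hw => (hrt hw).1.2).weaken (le_max_right _ _)) fun w hw hwf => ?_
    have hw0 : w ≠ 0 := (hrt hw).2
    have hwa := abs_arg_of_mem_frontier h0 h1 hw0 hwf
    simp only [logPolar, Complex.log_re, Complex.log_im, norm_neg]
    rcases abs_choice (Complex.arg w) with h | h
    · rw [h] at hwa
      rw [arg_neg_of_arg_eq (by linarith) (by linarith) hwa, hwa, hPQ]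
    · rw [h] at hwa
      have hwa' : Complex.arg w = -(α / 2) := by linarith
      rw [arg_neg_of_arg_eq_neg (by linarith) (by linarith) hwa', hwa', hPQ']
  · by_cases hzS : z ∈ complexSector α
    · obtain ⟨K, t, ht, hK⟩ := (contDiffAt_logPolar hk hP
        (mem_slitPlane_of_mem_complexSector h0 h1 hzS)).exists_lipschitzOnWith
      refine ⟨K, t ∩ complexSector α, inter_mem ht ((isOpen_complexSector α).mem_nhds hzS), ?_⟩
      intro x hx y hy
      rw [sectorPolar_of_mem hx.2, sectorPolar_of_mem hy.2]
      exact hK hx.1 hy.1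
    · have hc : z ∈ (closure (complexSector α))ᶜ := by
        intro hc
        rw [(isOpen_complexSector α).frontier_eq] at hf
        exact hf ⟨hc, hzS⟩
      have hd : ContDiffAt ℝ 1 (fun z => logPolar k Q (-z)) z :=
        (contDiffAt_logPolar hk hQ
          (neg_mem_slitPlane_of_notMem_complexSector h0 h1 hz hzS)).comp z
          contDiff_neg.contDiffAt
      obtain ⟨K, t, ht, hK⟩ := hd.exists_lipschitzOnWith
      refine ⟨K, t ∩ (closure (complexSector α))ᶜ,
        inter_mem ht (isClosed_closure.isOpen_compl.mem_nhds hc), ?_⟩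
      intro x hx y hy
      rw [sectorPolar_of_notMem fun h => hx.2 (subset_closure h),
        sectorPolar_of_notMem fun h => hy.2 (subset_closure h)]
      exact hK hx.1 hy.1

/-! ### L² norms in log-polar coordinates -/

/-- Integration in polar coordinates of a product, against the scale-invariant measure. -/
theorem lintegral_log_norm_mul_homogeneous {G : ℝ → ENNReal} {N : ℂ → ENNReal}
    (hG : Measurable G) (hN : Measurable N)
    (hh : ∀ (r : ℝ) (z : ℂ), 0 < r → N (r * z) = N z) :
    ∫⁻ z : ℂ, G (Real.log ‖z‖) * N z * ENNReal.ofReal (‖z‖⁻¹ ^ 2) =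
      (∫⁻ s, G s) * ∫⁻ θ in Ioo (-Real.pi) Real.pi,
        N (Real.cos θ + Real.sin θ * Complex.I) := by
  rw [← Complex.lintegral_comp_polarCoord_symm, polarCoord_target]
  -- The substitution r = exp s, that is ds = dr/r.
  have hexp : ∫⁻ s, G s = ∫⁻ r in Ioi (0 : ℝ), G (Real.log r) * ENNReal.ofReal r⁻¹ := by
    have h := lintegral_image_eq_lintegral_abs_deriv_mul (s := univ) (f := Real.exp)
      (f' := Real.exp) MeasurableSet.univ
      (fun x _ => (Real.hasDerivAt_exp x).hasDerivWithinAt) Real.exp_injective.injOn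
      (fun r => G (Real.log r) * ENNReal.ofReal r⁻¹)
    rw [image_univ, Real.range_exp, setLIntegral_univ] at h
    rw [h]
    refine lintegral_congr fun s => ?_
    rw [Real.log_exp, abs_of_pos (Real.exp_pos s), mul_left_comm,
      ← ENNReal.ofReal_mul (Real.exp_pos s).le, mul_inv_cancel₀ (Real.exp_pos s).ne']
    simp
  have hNm : Measurable fun θ : ℝ => N (Real.cos θ + Real.sin θ * Complex.I) :=
    hN.comp (by fun_prop)
  have hGm : Measurable fun r : ℝ => G (Real.log r) * ENNReal.ofReal r⁻¹ :=
    (hG.comp Real.measurable_log).mul (by fun_prop)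
  rw [hexp, ← lintegral_prod_mul hGm.aemeasurable hNm.aemeasurable,
    Measure.prod_restrict, ← Measure.volume_eq_prod]
  refine setLIntegral_congr_fun (measurableSet_Ioi.prod measurableSet_Ioo) fun p hp => ?_
  have hp1 : 0 < p.1 := hp.1
  simp only [Complex.norm_polarCoord_symm, abs_of_pos hp1, smul_eq_mul]
  rw [Complex.polarCoord_symm_apply, hh _ _ hp1]
  have h2 : ENNReal.ofReal p.1 * ENNReal.ofReal (p.1⁻¹ ^ 2) = ENNReal.ofReal p.1⁻¹ := by
    rw [← ENNReal.ofReal_mul hp1.le]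
    congr 1
    field_simp
  rw [mul_left_comm, h2]
  ring

open Classical in
theorem angular_real_mul (α : ℝ) (P Q : ℝ → ℝ) {r : ℝ} (hr : 0 < r) (z : ℂ) :
    angular α P Q (r * z) = angular α P Q z := by
  have h : (r * z : ℂ) ∈ complexSector α ↔ z ∈ complexSector α := by
    simp only [complexSector, mem_ofPred_eq, norm_mul, Complex.norm_real, Complex.re_ofReal_mul,
      Real.norm_of_nonneg hr.le, mul_left_comm _ r, mul_lt_mul_iff_right₀ hr]
  by_cases hz : z ∈ complexSector α
  · simp [angular, hz, h.2 hz, Complex.arg_real_mul _ hr]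
  · have : (r * z : ℂ) ∉ complexSector α := fun h' => hz (h.1 h')
    simp [angular, hz, this]
    rw [← mul_neg, Complex.arg_real_mul _ hr]

open Classical in
theorem measurable_angular {α : ℝ} {P Q : ℝ → ℝ} (hP : Measurable P) (hQ : Measurable Q) :
    Measurable (angular α P Q) :=
  Measurable.piecewise (isOpen_complexSector α).measurableSet (hP.comp Complex.measurable_arg)
    (hQ.comp (Complex.measurable_arg.comp measurable_neg))

open Classical in
/-- The `L²` norm in the plane of a function in polar coordinates, divided by the radius, is
proportional to the `L²` norm of its radial profile. -/
theorem exists_eLpNorm_sectorPolar_eq {α : ℝ} (h0 : 0 < α) (h1 : α < Real.pi) {P Q : ℝ → ℝ}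
    (hP : Continuous P) (hQ : Continuous Q) (hne : ∀ θ ∈ Ioo 0 (α / 2), P θ ≠ 0) :
    ∃ C : ENNReal, C ≠ 0 ∧ ∀ k : ℝ → ℝ, Continuous k →
      eLpNorm (fun z => sectorPolar α k P Q z * ‖z‖⁻¹) 2 volume = C * eLpNorm k 2 volume := by
  let N : ℂ → ENNReal := fun z => ‖angular α P Q z‖ₑ ^ (2 : ℝ)
  have hN : Measurable N :=
    (measurable_angular hP.measurable hQ.measurable).enorm.pow_const _
  have hh : ∀ (r : ℝ) (z : ℂ), 0 < r → N (r * z) = N z := fun r z hr => by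
    simp only [N, angular_real_mul α P Q hr]
  set I := ∫⁻ θ in Ioo (-Real.pi) Real.pi, N (Real.cos θ + Real.sin θ * Complex.I) with hI
  have hIm : Measurable fun θ : ℝ => N (Real.cos θ + Real.sin θ * Complex.I) :=
    hN.comp (by fun_prop)
  have hI0 : I ≠ 0 := by
    intro h
    rw [hI, setLIntegral_eq_zero_iff measurableSet_Ioo hIm] at h
    -- A zero angular integral would make `P` vanish almost everywhere on (0, α/2), where it has no
    -- zero.
    have h2 : volume (Ioo 0 (α / 2)) = 0 := by
      refine measure_mono_null (fun θ hθ => ?_) h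
      intro h3
      have hp := Real.pi_pos
      have hθ1 : θ ∈ Ioo (-Real.pi) Real.pi := ⟨by linarith [hθ.1], by linarith [hθ.2]⟩
      have h4 := h3 hθ1
      have harg : Complex.arg (Real.cos θ + Real.sin θ * Complex.I) = θ := by
        rw [Complex.ofReal_cos, Complex.ofReal_sin]
        exact Complex.arg_cos_add_sin_mul_I ⟨hθ1.1, hθ1.2.le⟩
      have hmem : (Real.cos θ + Real.sin θ * Complex.I : ℂ) ∈ complexSector α := by
        refine (mem_complexSector_iff h0 h1 ?_).2 ?_
        · intro h5
          rw [h5, Complex.arg_zero] at harg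
          exact hθ.1.ne harg
        · rw [harg, abs_of_pos hθ.1]; exact hθ.2
      simp only [N] at h4
      rw [ENNReal.rpow_eq_zero_iff_of_pos (by norm_num), enorm_eq_zero, angular,
        piecewise_eq_of_mem _ _ _ hmem, harg] at h4
      exact hne θ hθ h4
    rw [Real.volume_Ioo, ENNReal.ofReal_eq_zero] at h2
    linarith
  refine ⟨I ^ (1 / 2 : ℝ), ?_, fun k hk => ?_⟩
  · rw [Ne, ENNReal.rpow_eq_zero_iff_of_pos (by norm_num)]; exact hI0
  · have h := lintegral_log_norm_mul_homogeneous (G := fun s => ‖k s‖ₑ ^ (2 : ℝ))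
      (hk.measurable.enorm.pow_const _) hN hh
    rw [eLpNorm_eq_lintegral_rpow_enorm_toReal (by norm_num) (by norm_num),
      eLpNorm_eq_lintegral_rpow_enorm_toReal (by norm_num) (by norm_num), ENNReal.toReal_ofNat,
      ← ENNReal.mul_rpow_of_nonneg _ _ (by norm_num), mul_comm I, ← h]
    congr 1
    refine lintegral_congr fun z => ?_
    have hz : ENNReal.ofReal (‖z‖⁻¹ ^ 2) = ‖‖z‖⁻¹‖ₑ ^ (2 : ℝ) := by
      rw [← ofReal_norm, Real.norm_of_nonneg (by positivity),
        ENNReal.ofReal_rpow_of_nonneg (by positivity) (by norm_num)]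
      norm_num
    rw [hz, sectorPolar, enorm_mul, enorm_mul, ENNReal.mul_rpow_of_nonneg _ _ (by norm_num),
      ENNReal.mul_rpow_of_nonneg _ _ (by norm_num)]

/-! ### Truncated oscillations on the line -/

/-- A plateau function on the line, with its first two derivatives. -/
theorem exists_plateau : ∃ (χ χ₁ χ₂ : ℝ → ℝ) (C : ℝ), ContDiff ℝ 1 χ ∧ ContDiff ℝ 1 χ₁ ∧
    Continuous χ₂ ∧ (∀ s, HasDerivAt χ (χ₁ s) s) ∧ (∀ s, HasDerivAt χ₁ (χ₂ s) s) ∧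
    (∀ s, s ∉ Icc (-2 : ℝ) 2 → χ s = 0 ∧ χ₁ s = 0 ∧ χ₂ s = 0) ∧
    (∀ s ∈ Icc (-1 : ℝ) 1, χ s = 1) ∧ (∀ s, ‖χ₁ s‖ ≤ C) ∧ ∀ s, ‖χ₂ s‖ ≤ C := by
  let χ : ContDiffBump (0 : ℝ) := ⟨1, 2, one_pos, one_lt_two⟩
  have hχ : ContDiff ℝ ∞ χ := χ.contDiff
  have hχ1 : ContDiff ℝ ∞ (deriv χ) := (contDiff_infty_iff_deriv.1 hχ).2
  have hχ2 : ContDiff ℝ ∞ (deriv (deriv χ)) := (contDiff_infty_iff_deriv.1 hχ1).2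
  have hc1 : HasCompactSupport (deriv χ) := χ.hasCompactSupport.deriv
  obtain ⟨C₁, hC₁⟩ := hχ1.continuous.bounded_above_of_compact_support hc1
  obtain ⟨C₂, hC₂⟩ := hχ2.continuous.bounded_above_of_compact_support hc1.deriv
  have hts : tsupport χ = Icc (-2) 2 := by
    rw [χ.tsupport_eq, Real.closedBall_eq_Icc]; norm_num [χ]
  refine ⟨χ, deriv χ, deriv (deriv χ), max C₁ C₂, hχ.of_le (by simp), hχ1.of_le (by simp),
    hχ2.continuous, fun s => (hχ.differentiable (by simp) s).hasDerivAt,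
    fun s => (hχ1.differentiable (by simp) s).hasDerivAt, fun s hs => ⟨?_, ?_, ?_⟩,
    fun s hs => χ.one_of_mem_closedBall ?_, fun s => (hC₁ s).trans (le_max_left _ _),
    fun s => (hC₂ s).trans (le_max_right _ _)⟩
  · exact image_eq_zero_of_notMem_tsupport (by rwa [hts])
  · exact image_eq_zero_of_notMem_tsupport fun h => hs (hts ▸ tsupport_deriv_subset h)
  · exact image_eq_zero_of_notMem_tsupport fun h => hs
      (hts ▸ tsupport_deriv_subset (tsupport_deriv_subset h))
  · rw [mem_closedBall_zero_iff]
    exact abs_le.2 hs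

/-- A slowly truncated oscillation. -/
theorem exists_truncated_oscillation {ξ : ℝ} (hξ : 0 < ξ) : ∃ B : ℝ, 0 ≤ B ∧
    ∀ ε : ℝ, 0 < ε → ε ≤ 1 → ∃ g g₁ g₂ : ℝ → ℝ, ContDiff ℝ 1 g ∧ ContDiff ℝ 1 g₁ ∧ Continuous g₂ ∧
      (∀ s, HasDerivAt g (g₁ s) s) ∧ (∀ s, HasDerivAt g₁ (g₂ s) s) ∧
      (∀ s, s ∉ Icc (-(2 / ε)) (2 / ε) → g s = 0 ∧ g₁ s = 0 ∧ g₂ s = 0) ∧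
      (∀ s ∈ Icc (-1 : ℝ) 1, g s = Real.cos (ξ * s)) ∧ ∀ s, ‖ξ * g s + g₂ s / ξ‖ ≤ ε * B := by
  obtain ⟨χ, χ₁, χ₂, C, h0, h1, h2, hd0, hd1, hz, hone, hC₁, hC₂⟩ := exists_plateau
  have hC0 : 0 ≤ C := (norm_nonneg _).trans (hC₁ 0)
  -- For g(s) = χ(εs)cos(ξs) the terms without a derivative of χ cancel in ξg + g''/ξ. What remains
  -- is ε times (εχ''cos/ξ - 2χ'sin), and ε ≤ 1 gives this constant.
  refine ⟨C / ξ + 2 * C, by positivity, fun ε hε0 hε1 => ?_⟩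
  have hlin : ∀ c s : ℝ, HasDerivAt (fun s => c * s) c s := fun c s => by
    simpa using (hasDerivAt_id s).const_mul c
  have hcos : ∀ s, HasDerivAt (fun s => Real.cos (ξ * s)) (-Real.sin (ξ * s) * ξ) s := fun s =>
    (hlin ξ s).cos
  have hsin : ∀ s, HasDerivAt (fun s => Real.sin (ξ * s)) (Real.cos (ξ * s) * ξ) s := fun s =>
    (hlin ξ s).sin
  have hχε : ∀ s, HasDerivAt (fun s => χ (ε * s)) (χ₁ (ε * s) * ε) s := fun s =>
    (hd0 (ε * s)).comp s (hlin ε s)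
  have hχε1 : ∀ s, HasDerivAt (fun s => χ₁ (ε * s)) (χ₂ (ε * s) * ε) s :=
    fun s => (hd1 (ε * s)).comp s (hlin ε s)
  have hcε : ContDiff ℝ 1 fun s => χ (ε * s) := h0.comp (contDiff_const.mul contDiff_id)
  have hcε1 : ContDiff ℝ 1 fun s => χ₁ (ε * s) := h1.comp (contDiff_const.mul contDiff_id)
  have hcc : ContDiff ℝ 1 fun s => Real.cos (ξ * s) := by fun_prop
  have hcs : ContDiff ℝ 1 fun s => Real.sin (ξ * s) := by fun_prop
  refine ⟨fun s => χ (ε * s) * Real.cos (ξ * s),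
    fun s => ε * χ₁ (ε * s) * Real.cos (ξ * s) - ξ * χ (ε * s) * Real.sin (ξ * s),
    fun s => ε ^ 2 * χ₂ (ε * s) * Real.cos (ξ * s) - 2 * ε * ξ * χ₁ (ε * s) * Real.sin (ξ * s) -
      ξ ^ 2 * χ (ε * s) * Real.cos (ξ * s),
    hcε.mul hcc, ((contDiff_const.mul hcε1).mul hcc).sub ((contDiff_const.mul hcε).mul hcs),
    ?_, fun s => ?_, fun s => ?_, fun s hs => ?_, fun s hs => ?_, fun s => ?_⟩
  · have := h0.continuous
    have := h1.continuous
    fun_prop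
  · refine ((hχε s).mul (hcos s)).congr_deriv ?_
    ring
  · refine ((((hχε1 s).const_mul ε).mul (hcos s)).sub
      (((hχε s).const_mul ξ).mul (hsin s))).congr_deriv ?_
    ring
  · have hs' : ε * s ∉ Icc (-2 : ℝ) 2 := by
      refine fun h => hs ⟨?_, ?_⟩
      · rw [← neg_div, div_le_iff₀ hε0]; linarith [h.1]
      · rw [le_div_iff₀ hε0]; linarith [h.2]
    obtain ⟨e1, e2, e3⟩ := hz _ hs'
    simp [e1, e2, e3]
  · have h : ε * s ∈ Icc (-1 : ℝ) 1 := ⟨by nlinarith [hs.1], by nlinarith [hs.2]⟩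
    simp only [hone _ h, one_mul]
  · have e : ξ * (χ (ε * s) * Real.cos (ξ * s)) + (ε ^ 2 * χ₂ (ε * s) * Real.cos (ξ * s) -
        2 * ε * ξ * χ₁ (ε * s) * Real.sin (ξ * s) - ξ ^ 2 * χ (ε * s) * Real.cos (ξ * s)) / ξ =
        ε * (ε * χ₂ (ε * s) * Real.cos (ξ * s) / ξ - 2 * χ₁ (ε * s) * Real.sin (ξ * s)) := by
      field_simp; ring
    rw [e, norm_mul, Real.norm_of_nonneg hε0.le]
    refine mul_le_mul_of_nonneg_left ((norm_sub_le _ _).trans (add_le_add ?_ ?_)) hε0.le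
    · rw [norm_div, Real.norm_of_nonneg hξ.le, norm_mul, norm_mul, Real.norm_of_nonneg hε0.le]
      refine div_le_div_of_nonneg_right ?_ hξ.le
      calc ε * ‖χ₂ (ε * s)‖ * ‖Real.cos (ξ * s)‖ ≤ 1 * C * 1 :=
            mul_le_mul (mul_le_mul hε1 (hC₂ _) (norm_nonneg _) zero_le_one)
              (Real.abs_cos_le_one _) (norm_nonneg _) (by positivity)
        _ = C := by ring
    · rw [norm_mul, norm_mul, Real.norm_two]
      calc 2 * ‖χ₁ (ε * s)‖ * ‖Real.sin (ξ * s)‖ ≤ 2 * C * 1 :=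
            mul_le_mul (mul_le_mul_of_nonneg_left (hC₁ _) zero_le_two)
              (Real.abs_sin_le_one _) (norm_nonneg _) (by positivity)
        _ = 2 * C := by ring

/-- Every `ξ²` is an approximate eigenvalue of `-d²/ds²`, with test functions as approximate
eigenvectors. -/
theorem exists_approx_oscillation {ξ : ℝ} (hξ : 0 < ξ) {δ : ℝ} (hδ : 0 < δ) (b : ℝ) :
    ∃ (a : ℝ) (g g₁ g₂ : ℝ → ℝ), ContDiff ℝ 1 g ∧ ContDiff ℝ 1 g₁ ∧ Continuous g₂ ∧
      (∀ s, HasDerivAt g (g₁ s) s) ∧ (∀ s, HasDerivAt g₁ (g₂ s) s) ∧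
      (∀ s, s ∉ Icc a b → g s = 0) ∧ (∀ s, s ∉ Icc a b → g₁ s = 0) ∧
      eLpNorm g 2 volume ≠ 0 ∧
      eLpNorm (fun s => ξ * g s + g₂ s / ξ) 2 volume ≤ ENNReal.ofReal δ * eLpNorm g 2 volume := by
  obtain ⟨B, hB0, hB⟩ := exists_truncated_oscillation hξ
  set c₀ := eLpNorm (fun s => Real.cos (ξ * s)) 2 (volume.restrict (Icc (-1) 1)) with hc₀
  have hc₀0 : c₀ ≠ 0 := by
    rw [hc₀, Ne, eLpNorm_eq_zero_iff (by fun_prop) (by norm_num)]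
    intro h
    have h2 := Measure.eqOn_of_ae_eq h (by fun_prop) continuousOn_const (by
      rw [interior_Icc, closure_Ioo (by norm_num)])
    simpa using h2 (x := 0) (by norm_num)
  have hc₀t : c₀ ≠ ⊤ :=
    (MemLp.of_bound (by fun_prop) 1 (Eventually.of_forall fun s => Real.abs_cos_le_one _)).2.ne
  -- The defect has size at most εB on an interval of length 4/ε, hence L² norm at most 2B√ε, while
  -- the L² norm of the profile stays above `c₀`.
  obtain ⟨ε, hε0, hε1, hεδ⟩ : ∃ ε : ℝ, 0 < ε ∧ ε ≤ 1 ∧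
      ENNReal.ofReal (4 / ε) ^ (1 / 2 : ℝ) * ENNReal.ofReal (ε * B) ≤
        ENNReal.ofReal δ * c₀ := by
    have hpos : 0 < δ * c₀.toReal := mul_pos hδ (ENNReal.toReal_pos hc₀0 hc₀t)
    have ht : Tendsto (fun ε : ℝ => 2 * B * √ε) (𝓝[>] 0) (𝓝 0) := by
      have : Continuous fun ε : ℝ => 2 * B * √ε := by fun_prop
      simpa using (this.tendsto 0).mono_left nhdsWithin_le_nhds
    obtain ⟨ε, h1, h2, h3⟩ := ((ht.eventually (gt_mem_nhds hpos)).and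
      (Ioo_mem_nhdsGT (zero_lt_one' ℝ))).exists
    refine ⟨ε, h2, h3.le, ?_⟩
    rw [ENNReal.ofReal_rpow_of_nonneg (by positivity) (by norm_num),
      ← ENNReal.ofReal_mul (by positivity), ← ENNReal.ofReal_toReal hc₀t,
      ← ENNReal.ofReal_mul hδ.le]
    refine ENNReal.ofReal_le_ofReal (le_trans (le_of_eq ?_) h1.le)
    rw [← Real.sqrt_eq_rpow, Real.sqrt_div (by norm_num), show (4 : ℝ) = 2 ^ 2 by norm_num,
      Real.sqrt_sq (by norm_num)]
    have hs := Real.mul_self_sqrt h2.le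
    have hs0 := Real.sqrt_pos.2 h2
    field_simp
    rw [sq, hs]
  obtain ⟨γ, γ₁, γ₂, hγc, hγ1c, hγ2c, hγ, hγ1, hz, hone, hbd⟩ := hB ε hε0 hε1
  have hup : eLpNorm (fun s => ξ * γ s + γ₂ s / ξ) 2 volume ≤ ENNReal.ofReal δ * c₀ := by
    refine le_trans ?_ hεδ
    have hsupp : Function.support (fun s => ξ * γ s + γ₂ s / ξ) ⊆ Icc (-(2 / ε)) (2 / ε) := by
      intro s hs
      by_contra h
      obtain ⟨e1, e2, e3⟩ := hz s h
      exact hs (by simp [e1, e3])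
    rw [← eLpNorm_restrict_eq_of_support_subset hsupp]
    refine (eLpNorm_le_of_ae_bound (Eventually.of_forall hbd)).trans (le_of_eq ?_)
    rw [Measure.restrict_apply_univ, Real.volume_Icc, ENNReal.toReal_ofNat]
    congr 2
    · congr 1; ring
    · norm_num
  have hlow : c₀ ≤ eLpNorm γ 2 volume := by
    refine le_trans (le_of_eq ?_)
      (eLpNorm_mono_measure γ (Measure.restrict_le_self (s := Icc (-1) 1)))
    refine eLpNorm_congr_ae ?_
    filter_upwards [ae_restrict_mem measurableSet_Icc] with s hs
    rw [hone s hs]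
  -- Translation carries the support interval [-2/ε, 2/ε] to [b - 4/ε, b] and leaves both L² norms
  -- unchanged.
  set T := b - 2 / ε with hTdef
  have hT : MeasurePreserving (fun s : ℝ => s - T) volume volume := measurePreserving_sub_right _ T
  have hγcont := hγc.continuous
  have hn1 : eLpNorm (fun s => γ (s - T)) 2 volume = eLpNorm γ 2 volume :=
    eLpNorm_comp_measurePreserving hγcont.aestronglyMeasurable hT
  have hn2 : eLpNorm (fun s => ξ * γ (s - T) + γ₂ (s - T) / ξ) 2 volume =
      eLpNorm (fun s => ξ * γ s + γ₂ s / ξ) 2 volume :=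
    eLpNorm_comp_measurePreserving (g := fun s => ξ * γ s + γ₂ s / ξ)
      (Continuous.aestronglyMeasurable (by fun_prop)) hT
  have hout : ∀ s, s ∉ Icc (b - 4 / ε) b → s - T ∉ Icc (-(2 / ε)) (2 / ε) := by
    intro s hs h
    have h4 : (4 : ℝ) / ε = 2 / ε + 2 / ε := by ring
    exact hs ⟨by linarith [h.1], by linarith [h.2]⟩
  refine ⟨b - 4 / ε, fun s => γ (s - T), fun s => γ₁ (s - T), fun s => γ₂ (s - T),
    hγc.comp (contDiff_id.sub contDiff_const), hγ1c.comp (contDiff_id.sub contDiff_const),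
    by fun_prop,
    fun s => (hγ (s - T)).comp_sub_const s T, fun s => (hγ1 (s - T)).comp_sub_const s T,
    fun s hs => (hz _ (hout s hs)).1, fun s hs => (hz _ (hout s hs)).2.1, ?_, ?_⟩
  · rw [hn1]
    exact (hlow.trans_lt' (pos_iff_ne_zero.2 hc₀0)).ne'
  · rw [hn1, hn2]
    exact hup.trans (by gcongr)

/-! ### The dispersion relation -/

/-- The dispersion relation of the corner. -/
theorem exists_sinh_eq_mul_sinh {α μ : ℝ} (h0 : 0 < α) (h1 : α < Real.pi) (hμ0 : 0 < μ)
    (hμ1 : μ < 1 - α / Real.pi) :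
    ∃ ξ > 0, μ * Real.sinh (ξ * Real.pi) = Real.sinh (ξ * (Real.pi - α)) := by
  let q : ℝ → ℝ := fun ξ => μ * Real.sinh (ξ * Real.pi) - Real.sinh (ξ * (Real.pi - α))
  have hq : Continuous q := by fun_prop
  -- `q` vanishes at 0 with slope μπ - (π - α), negative exactly because μ < 1 - α/π.
  have hneg : ∃ x > 0, q x < 0 := by
    have hlin : ∀ c : ℝ, HasDerivAt (fun s : ℝ => s * c) c 0 := fun c => by
      simpa using (hasDerivAt_id (0 : ℝ)).mul_const c
    have hd : HasDerivAt q (μ * Real.pi - (Real.pi - α)) 0 := by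
      refine (((hlin Real.pi).sinh.const_mul μ).sub (hlin (Real.pi - α)).sinh).congr_deriv ?_
      simp
    have hlt : μ * Real.pi - (Real.pi - α) < 0 := by
      have := mul_lt_mul_of_pos_right hμ1 Real.pi_pos
      rw [sub_mul, div_mul_cancel₀ _ Real.pi_ne_zero] at this
      linarith
    have hs := hd.tendsto_slope_zero_right
    obtain ⟨x, hx1, hx2⟩ := ((hs.eventually (gt_mem_nhds hlt)).and self_mem_nhdsWithin).exists
    refine ⟨x, hx2, ?_⟩
    have hx2' : 0 < x := hx2
    have hq0 : q 0 = 0 := by simp [q]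
    rw [zero_add, hq0, sub_zero, smul_eq_mul] at hx1
    by_contra hc
    rw [not_lt] at hc
    exact absurd hx1 (not_lt.2 (mul_nonneg (inv_nonneg.2 hx2'.le) hc))
  obtain ⟨x, hx, hqx⟩ := hneg
  have hpos : ∃ y > x, 0 < q y := by
    -- From y ≥ 1/(μα) one gets μ cosh(yα) > μyα ≥ 1, and the addition formula for sinh(yπ) makes `q
    -- y` positive.
    refine ⟨max (x + 1) (1 / (μ * α)), (lt_add_one x).trans_le (le_max_left _ _), ?_⟩
    set y := max (x + 1) (1 / (μ * α)) with hy
    have hyx : x + 1 ≤ y := le_max_left _ _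
    have hy1 : 1 / (μ * α) ≤ y := le_max_right _ _
    have hy0 : 0 < y := by linarith
    have hs : 0 < Real.sinh (y * (Real.pi - α)) := Real.sinh_pos_iff.2 (mul_pos hy0 (by linarith))
    have hsa : y * α < Real.sinh (y * α) := Real.self_lt_sinh_iff.2 (mul_pos hy0 h0)
    have hca : Real.sinh (y * α) < Real.cosh (y * α) := Real.sinh_lt_cosh _
    have hc1 := Real.cosh_pos (y * (Real.pi - α))
    have e : Real.sinh (y * Real.pi) = Real.sinh (y * (Real.pi - α)) * Real.cosh (y * α) +
        Real.cosh (y * (Real.pi - α)) * Real.sinh (y * α) := by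
      rw [← Real.sinh_add]; ring_nf
    have h3 : 1 ≤ μ * (y * α) := by
      rw [div_le_iff₀ (by positivity)] at hy1
      linarith
    have h4 : 1 < μ * Real.cosh (y * α) :=
      h3.trans_lt (mul_lt_mul_of_pos_left (hsa.trans hca) hμ0)
    have h5 : 0 < μ * (Real.cosh (y * (Real.pi - α)) * Real.sinh (y * α)) :=
      mul_pos hμ0 (mul_pos hc1 ((mul_pos hy0 h0).trans hsa))
    simp only [q]
    rw [e]
    nlinarith [mul_lt_mul_of_pos_left h4 hs]
  obtain ⟨y, hy, hqy⟩ := hpos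
  obtain ⟨ξ, hξ, h⟩ := intermediate_value_Icc hy.le hq.continuousOn ⟨hqx.le, hqy.le⟩
  exact ⟨ξ, hx.trans_le hξ.1, sub_eq_zero.1 h⟩

/-! ### Transfer between the Euclidean plane and ℂ -/

/-- The identification of the Euclidean plane with `ℂ`. -/
noncomputable def planeToComplex : Plane ≃ₗᵢ[ℝ] ℂ := Complex.orthonormalBasisOneI.repr.symm

theorem planeToComplex_apply (x : Plane) : planeToComplex x = x 0 + x 1 * Complex.I := by
  simp [planeToComplex, Complex.orthonormalBasisOneI_repr_symm_apply]

theorem measurePreserving_planeToComplex : MeasurePreserving planeToComplex volume volume :=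
  planeToComplex.measurePreserving

theorem mem_sector_iff {α : ℝ} (h0 : 0 < α) (h1 : α < Real.pi) (x : Plane) :
    x ∈ sector α ↔ planeToComplex x ∈ complexSector α := by
  have harg : ∀ r θ : ℝ, 0 < r → |θ| < α / 2 →
      Complex.arg (r * (Complex.cos θ + Complex.sin θ * Complex.I)) = θ := fun r θ hr hθ => by
    rw [abs_lt] at hθ
    exact Complex.arg_mul_cos_add_sin_mul_I hr ⟨by linarith, by linarith⟩
  constructor
  · rintro ⟨r, θ, hr, hθ, rfl⟩
    have e : planeToComplex !₂[r * Real.cos θ, r * Real.sin θ] =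
        r * (Complex.cos θ + Complex.sin θ * Complex.I) := by
      rw [planeToComplex_apply]; simp; ring
    have hne : (r * (Complex.cos θ + Complex.sin θ * Complex.I) : ℂ) ≠ 0 := by
      rw [← norm_ne_zero_iff, Complex.norm_mul, Complex.norm_cos_add_sin_mul_I]
      simpa using hr.ne'
    rw [e, mem_complexSector_iff h0 h1 hne, harg r θ hr hθ]
    exact hθ
  · intro h
    set z := planeToComplex x with hz
    have hz0 : z ≠ 0 := by
      intro h'
      rw [h'] at h
      simp [complexSector] at h
    refine ⟨‖z‖, Complex.arg z, norm_pos_iff.2 hz0, (mem_complexSector_iff h0 h1 hz0).1 h, ?_⟩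
    rw [Complex.norm_mul_cos_arg, Complex.norm_mul_sin_arg, hz, planeToComplex_apply]
    ext i
    fin_cases i <;> simp

/-- The vector corresponding to the covector `p ds + q dθ`, where `s + iθ = log z`. -/
noncomputable def polarField (z : ℂ) (p q : ℝ) : Plane :=
  !₂[z⁻¹.re * p + z⁻¹.im * q, -(z⁻¹.im * p) + z⁻¹.re * q]

/-- The logarithm is conformal with factor 1/|z|, so ds and dθ are orthogonal of equal length. -/
theorem norm_sq_polarField (z : ℂ) (p q : ℝ) :
    ‖polarField z p q‖ ^ 2 = (p ^ 2 + q ^ 2) * ‖z‖⁻¹ ^ 2 := by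
  rw [← norm_inv, ← Complex.normSq_eq_norm_sq, Complex.normSq_apply, EuclideanSpace.norm_sq_eq]
  simp only [polarField, Fin.sum_univ_two, Real.norm_eq_abs, sq_abs]
  simp
  ring

theorem norm_polarField_zero_left (z : ℂ) (q : ℝ) : ‖polarField z 0 q‖ = ‖q * ‖z‖⁻¹‖ := by
  refine (sq_eq_sq₀ (norm_nonneg _) (norm_nonneg _)).1 ?_
  rw [norm_sq_polarField, Real.norm_eq_abs, sq_abs]
  ring

theorem norm_le_norm_polarField (z : ℂ) (p q : ℝ) : ‖q * ‖z‖⁻¹‖ ≤ ‖polarField z p q‖ := by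
  refine (sq_le_sq₀ (norm_nonneg _) (norm_nonneg _)).1 ?_
  rw [norm_sq_polarField, Real.norm_eq_abs, sq_abs, mul_pow]
  exact mul_le_mul_of_nonneg_right (by linarith [sq_nonneg p]) (sq_nonneg _)

theorem gradient_comp_planeToComplex {f : ℂ → ℝ} {x : Plane} {p q : ℝ}
    (h : HasFDerivAt f (logPolarCovector (planeToComplex x) p q) (planeToComplex x)) :
    gradient (fun x => f (planeToComplex x)) x = polarField (planeToComplex x) p q := by
  have h2 : HasFDerivAt (fun x => f (planeToComplex x))
      ((logPolarCovector (planeToComplex x) p q).comp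
        (planeToComplex : Plane ≃L[ℝ] ℂ).toContinuousLinearMap) x :=
    h.comp x (planeToComplex : Plane ≃L[ℝ] ℂ).hasFDerivAt
  have e0 : planeToComplex (EuclideanSpace.single 0 1) = 1 := by
    rw [planeToComplex_apply]; simp
  have e1 : planeToComplex (EuclideanSpace.single 1 1) = Complex.I := by
    rw [planeToComplex_apply]; simp
  ext i
  rw [gradient_apply, h2.fderiv]
  fin_cases i
  · change logPolarCovector _ p q (planeToComplex (EuclideanSpace.single 0 1)) = _
    rw [e0, logPolarCovector_apply]
    simp only [polarField, mul_one]
    simp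
    ring
  · change logPolarCovector _ p q (planeToComplex (EuclideanSpace.single 1 1)) = _
    rw [e1, logPolarCovector_apply]
    simp only [polarField, Complex.mul_I_re, Complex.mul_I_im]
    simp
    ring

/-- The frontier of a convex set has measure zero. -/
theorem ae_planeToComplex_notMem_frontier {α : ℝ} (h0 : 0 < α) (h1 : α < Real.pi) :
    ∀ᵐ x : Plane, planeToComplex x ≠ 0 ∧ planeToComplex x ∉ frontier (complexSector α) := by
  have h : ∀ᵐ z : ℂ, z ≠ 0 ∧ z ∉ frontier (complexSector α) := by
    refine (Measure.ae_ne volume 0).and ?_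
    exact measure_eq_zero_iff_ae_notMem.1 ((convex_complexSector h0 h1).addHaar_frontier volume)
  exact measurePreserving_planeToComplex.quasiMeasurePreserving.ae h

theorem measurable_sectorPolar {α : ℝ} {k P Q : ℝ → ℝ} (hk : Measurable k) (hP : Measurable P)
    (hQ : Measurable Q) : Measurable (sectorPolar α k P Q) :=
  (hk.comp (Real.measurable_log.comp measurable_norm)).mul (measurable_angular hP hQ)

theorem IsCornerInclusion.zero_mem {Ω : BoundedOpen} {D : Set Plane} {α : ℝ}
    (hD : IsCornerInclusion Ω D α) : (0 : Plane) ∈ Ω.carrier := by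
  obtain ⟨R, hR, hDR⟩ := hD.corner
  refine hD.closure_subset (Metric.mem_closure_iff.2 fun ε hε => ?_)
  have hm : 0 < min ε R / 2 := half_pos (lt_min hε hR)
  have hlt : min ε R / 2 < min ε R := half_lt_self (lt_min hε hR)
  have hn : ‖(!₂[min ε R / 2, 0] : Plane)‖ = min ε R / 2 := by
    rw [EuclideanSpace.norm_eq, Fin.sum_univ_two]
    simp [Real.sqrt_sq hm.le, abs_of_pos (lt_min hε hR)]
  refine ⟨!₂[min ε R / 2, 0], ?_, ?_⟩
  · have : (!₂[min ε R / 2, 0] : Plane) ∈ sector α ∩ Metric.ball 0 R := by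
      refine ⟨⟨min ε R / 2, 0, hm, by simpa using hD.angle_pos, by simp⟩, ?_⟩
      rw [mem_ball_zero_iff, hn]
      exact hlt.trans_le (min_le_right _ _)
    rw [← hDR] at this
    exact this.1
  · rw [dist_zero_left, hn]
    exact hlt.trans_le (min_le_left _ _)

/-! ### Approximate eigenvectors from angular modes -/

namespace SobolevH10

variable {Ω : BoundedOpen} {D : Set Plane} {α : ℝ}

/-- An element of `H^1_0(Ω)` which is small against its residual gives, after normalization, an
approximate eigenvector. -/
theorem exists_unit_of_norm_le {β ε : ℝ} {U : SobolevH10 Ω} (hU : U ≠ 0)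
    (hT : ‖β • U - poincareOp Ω D U‖ ≤ ε * ‖U‖) (h0 : ∀ᵐ x ∂volOn Ω, ε ≤ ‖x‖ → grad U x = 0) :
    ∃ V : SobolevH10 Ω, ‖V‖ = 1 ∧ ‖β • V - poincareOp Ω D V‖ ≤ ε ∧
      ∀ᵐ x ∂volOn Ω, ε ≤ ‖x‖ → grad V x = 0 := by
  have hp := norm_pos_iff.2 hU
  refine ⟨‖U‖⁻¹ • U, ?_, ?_, ?_⟩
  · rw [norm_smul, norm_inv, norm_norm, inv_mul_cancel₀ hp.ne']
  · rw [map_smul, smul_comm, ← smul_sub, norm_smul, norm_inv, norm_norm, inv_mul_le_iff₀ hp,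
      mul_comm]
    exact hT
  · rw [map_smul]
    filter_upwards [h0, Lp.coeFn_smul ‖U‖⁻¹ (grad U)] with x hx hx2 hε
    rw [hx2, Pi.smul_apply, hx hε, smul_zero]

/-- Separated solutions `r^{iξ} Φ(θ)` of `div ((β - 1_D) ∇u) = 0` near a corner, where
`Φ` is given by `P` in the sector and by `Q` outside (as a function of `arg (-z)`), and where
`ξ⁻¹ (β - 1_D) Φ'` is given by `R`, `S`, show that `β` is an approximate eigenvalue. -/
theorem isApproxEigenvalueAtZero_of_angular_mode (hD : IsCornerInclusion Ω D α) {β ξ : ℝ}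
    (hβ0 : 0 < β) (hβ1 : β < 1) (hξ : 0 < ξ) {P Q R S : ℝ → ℝ}
    (hPc : ContDiff ℝ 1 P) (hQc : ContDiff ℝ 1 Q) (hRc : ContDiff ℝ 1 R) (hSc : ContDiff ℝ 1 S)
    (hP : ∀ s, HasDerivAt P (ξ * R s / (β - 1)) s) (hQ : ∀ s, HasDerivAt Q (ξ * S s / β) s)
    (hR : ∀ s, HasDerivAt R (ξ * (β - 1) * P s) s) (hS : ∀ s, HasDerivAt S (ξ * β * Q s) s)
    (hPQ : P (α / 2) = Q (α / 2 - Real.pi)) (hPQ' : P (-(α / 2)) = Q (Real.pi - α / 2))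
    (hRS : R (α / 2) = S (α / 2 - Real.pi)) (hRS' : R (-(α / 2)) = S (Real.pi - α / 2))
    (hne : ∀ θ ∈ Ioo 0 (α / 2), R θ ≠ 0) : IsApproxEigenvalueAtZero Ω D β := by
  classical
  intro ε hε
  have h0 := hD.angle_pos
  have h1 := hD.angle_lt
  have hβ1' : β - 1 ≠ 0 := by linarith
  obtain ⟨R₀, hR₀, hDR⟩ := hD.corner
  obtain ⟨ρ, hρ, hρΩ⟩ := Metric.isOpen_iff.1 Ω.isOpen 0 hD.zero_mem
  -- The disc of radius τ will contain the support: it lies in the region where D is the sector,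
  -- inside `Ω`, within ε of the corner, and τ < 1 makes log τ negative.
  obtain ⟨τ, hτ0, hτ⟩ := exists_between (lt_min (lt_min hR₀ hρ) (lt_min hε one_pos))
  have hτR : τ < R₀ := hτ.trans_le ((min_le_left _ _).trans (min_le_left _ _))
  have hτρ : τ < ρ := hτ.trans_le ((min_le_left _ _).trans (min_le_right _ _))
  have hτε : τ < ε := hτ.trans_le ((min_le_right _ _).trans (min_le_left _ _))
  have hτ1 : τ < 1 := hτ.trans_le ((min_le_right _ _).trans (min_le_right _ _))
  have hb : Real.log τ < 0 := Real.log_neg hτ0 hτ1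
  -- The tolerance εξ anticipates the lower bound Cξ‖g‖ for ‖∇u‖.
  obtain ⟨a, g, g₁, g₂, hg, hg1, hg2, hgd, hgd1, hgz, hgz1, hgne, hgle⟩ :=
    exists_approx_oscillation hξ (mul_pos hε hξ) (Real.log τ)
  obtain ⟨C, hC0, hC⟩ := exists_eLpNorm_sectorPolar_eq h0 h1 hRc.continuous hSc.continuous hne
  have hvan : ∀ (k A B : ℝ → ℝ), (∀ s, s ∉ Icc a (Real.log τ) → k s = 0) → ∀ x : Plane, τ < ‖x‖ →
      sectorPolar α k A B (planeToComplex x) = 0 := fun k A B hk x hx => by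
    refine sectorPolar_eq_zero hk hb fun h => ?_
    have h2 := h.1
    rw [mem_closedBall_zero_iff, planeToComplex.norm_map, Real.exp_log hτ0] at h2
    linarith
  have hlip : ∀ f : ℂ → ℝ, (∃ K, LipschitzWith K f) →
      ∃ K, LipschitzWith K fun x : Plane => f (planeToComplex x) := fun f ⟨K, hK⟩ =>
    ⟨K * 1, hK.comp planeToComplex.lipschitz⟩
  set u : Plane → ℝ := fun x => sectorPolar α g P Q (planeToComplex x) with hu
  -- Approximate conjugate function of `u`: its θ-derivative is exactly the radial flux σg'Φ,
  -- because R' = ξσΦ. Continuity of the flux across the sides makes it Lipschitz.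
  set ψ : Plane → ℝ := fun x => sectorPolar α (fun s => g₁ s / ξ) R S (planeToComplex x) with hψ
  obtain ⟨K, huK⟩ : ∃ K, LipschitzWith K u :=
    hlip _ (exists_lipschitzWith_sectorPolar h0 h1 hg hPc hQc hgz hb hPQ hPQ')
  obtain ⟨K', hψK⟩ : ∃ K, LipschitzWith K ψ :=
    hlip _ (exists_lipschitzWith_sectorPolar h0 h1 (hg1.div_const ξ) hRc hSc
      (fun s hs => by rw [hgz1 s hs, zero_div]) hb hRS hRS')
  have hus : tsupport u ⊆ Metric.closedBall 0 τ := by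
    refine closure_minimal (fun x hx => ?_) Metric.isClosed_closedBall
    by_contra h
    rw [mem_closedBall_zero_iff, not_le] at h
    exact hx (hvan g P Q hgz x h)
  have huΩ : tsupport u ⊆ Ω.carrier := hus.trans
    ((Metric.closedBall_subset_ball hτρ).trans hρΩ)
  have huc : HasCompactSupport u :=
    (isCompact_closedBall (0 : Plane) τ).of_isClosed_subset (isClosed_tsupport u) hus
  obtain ⟨U, hU⟩ := exists_grad_eq_of_lipschitz huK huc huΩ
  have hgrad0 : ∀ x, x ∉ tsupport u → gradient u x = 0 := fun x hx => by
    have : fderiv ℝ u x = 0 := by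
      by_contra h
      exact hx (support_fderiv_subset ℝ h)
    simp [gradient, this]
  have hgradu : ∀ x : Plane, planeToComplex x ≠ 0 →
      planeToComplex x ∉ frontier (complexSector α) → gradient u x = polarField (planeToComplex x)
        (sectorPolar α g₁ P Q (planeToComplex x)) (sectorPolar α g (fun s => ξ * R s / (β - 1))
          (fun s => ξ * S s / β) (planeToComplex x)) := fun x hx hx' =>
    gradient_comp_planeToComplex (hasFDerivAt_sectorPolar h0 h1 hgd hP hQ hx hx')
  have hgradψ : ∀ x : Plane, planeToComplex x ≠ 0 →
      planeToComplex x ∉ frontier (complexSector α) → gradient ψ x = polarField (planeToComplex x)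
        (sectorPolar α (fun s => g₂ s / ξ) R S (planeToComplex x))
        (sectorPolar α (fun s => g₁ s / ξ) (fun s => ξ * (β - 1) * P s)
          (fun s => ξ * β * Q s) (planeToComplex x)) := fun x hx hx' =>
    gradient_comp_planeToComplex (hasFDerivAt_sectorPolar h0 h1
      (fun s => (hgd1 s).div_const ξ) hR hS hx hx')
  have hDm : MeasurableSet D := hD.isOpen.measurableSet
  have hDmem : ∀ x : Plane, ‖x‖ < R₀ → (x ∈ D ↔ planeToComplex x ∈ complexSector α) := by
    intro x hx
    rw [← mem_sector_iff h0 h1]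
    have hxb : x ∈ Metric.ball (0 : Plane) R₀ := mem_ball_zero_iff.2 hx
    have := Set.ext_iff.1 hDR x
    simpa [hx] using this
  let F : Plane → Plane := fun x => β • grad U x - D.indicator (grad U) x - rotGradient ψ x
  have hF : MemLp F 2 (volOn Ω) :=
    (((Lp.memLp (grad U)).const_smul β).sub ((Lp.memLp (grad U)).indicator hDm)).sub
      (memLp_rotGradient hψK)
  set k : ℝ → ℝ := fun s => ξ * g s + g₂ s / ξ with hk
  have hkc : Continuous k := by
    have := hg.continuous
    fun_prop
  -- The radial components cancel exactly; the angular ones leave σgΦ' + g''R/ξ = (ξg + g''/ξ)R.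
  have hFeq : ∀ᵐ x ∂volOn Ω, F x = polarField (planeToComplex x) 0
      (sectorPolar α k R S (planeToComplex x)) := by
    filter_upwards [hU, ae_restrict_of_ae (ae_planeToComplex_notMem_frontier h0 h1)]
      with x hx ⟨hx0, hxf⟩
    have hsplit : β • grad U x - D.indicator (grad U) x = if planeToComplex x ∈ complexSector α
        then (β - 1) • gradient u x else β • gradient u x := by
      by_cases hxR : ‖x‖ < R₀
      · by_cases hxD : x ∈ D
        · rw [if_pos ((hDmem x hxR).1 hxD), indicator_of_mem hxD, hx, sub_smul, one_smul]
        · rw [if_neg (fun h => hxD ((hDmem x hxR).2 h)), indicator_of_notMem hxD, hx, sub_zero]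
      -- Away from the corner D need not be the sector, but ∇u vanishes there.
      · have hz : gradient u x = 0 := hgrad0 x fun h => by
          have := hus h
          rw [mem_closedBall_zero_iff] at this
          linarith
        have hz' : D.indicator (grad U) x = 0 := by
          by_cases hxD : x ∈ D <;> simp [hxD, hx, hz]
        rw [hz', hx, hz]
        simp
    simp only [F]
    rw [hsplit]
    have hξ0 := hξ.ne'
    have hβ00 := hβ0.ne'
    by_cases hs : planeToComplex x ∈ complexSector α
    · rw [if_pos hs, rotGradient, hgradψ x hx0 hxf, hgradu x hx0 hxf]
      simp only [sectorPolar, angular, hs, piecewise_eq_of_mem, polarField, hk]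
      ext i
      fin_cases i
      all_goals
        simp
        field_simp
        ring
    · rw [if_neg hs, rotGradient, hgradψ x hx0 hxf, hgradu x hx0 hxf]
      simp only [sectorPolar, angular, hs, not_false_iff, piecewise_eq_of_notMem, polarField, hk]
      ext i
      fin_cases i
      all_goals
        simp
        field_simp
        ring
  have htrans : ∀ k : ℝ → ℝ, Continuous k → eLpNorm (fun x : Plane =>
      sectorPolar α k R S (planeToComplex x) * ‖planeToComplex x‖⁻¹) 2 volume =
        C * eLpNorm k 2 volume := fun k hkc => by
    rw [← hC k hkc]
    refine eLpNorm_comp_measurePreserving (g := fun z => sectorPolar α k R S z * ‖z‖⁻¹) ?_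
      measurePreserving_planeToComplex
    exact ((measurable_sectorPolar hkc.measurable hRc.continuous.measurable
      hSc.continuous.measurable).mul measurable_norm.inv).aestronglyMeasurable
  have hFle : eLpNorm F 2 (volOn Ω) ≤ C * (ENNReal.ofReal (ε * ξ) * eLpNorm g 2 volume) := by
    calc eLpNorm F 2 (volOn Ω) ≤ eLpNorm (fun x : Plane =>
          sectorPolar α k R S (planeToComplex x) * ‖planeToComplex x‖⁻¹) 2 (volOn Ω) := by
          refine eLpNorm_mono_ae ?_
          filter_upwards [hFeq] with x hx
          rw [hx, norm_polarField_zero_left]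
      _ ≤ C * eLpNorm k 2 volume := by
          rw [← htrans k hkc]
          exact eLpNorm_mono_measure _ Measure.restrict_le_self
      _ ≤ _ := by gcongr
  -- The angular component alone suffices: |gΦ'| = ξ|gR|/|σ| ≥ ξ|gR|, as |β| and |β - 1| are at most
  -- 1.
  have hUge : C * (ENNReal.ofReal ξ * eLpNorm g 2 volume) ≤ eLpNorm (grad U) 2 (volOn Ω) := by
    have e1 : ENNReal.ofReal ξ * eLpNorm g 2 volume = eLpNorm (fun s => ξ * g s) 2 volume := by
      have := eLpNorm_const_smul ξ g 2 (volume : Measure ℝ)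
      rw [← ofReal_norm, Real.norm_of_nonneg hξ.le] at this
      exact this.symm
    have e2 : eLpNorm (grad U) 2 (volOn Ω) = eLpNorm (gradient u) 2 volume := by
      rw [eLpNorm_congr_ae hU]
      refine eLpNorm_restrict_eq_of_support_subset fun x hx => ?_
      by_contra h
      exact hx (hgrad0 x fun h' => h (huΩ h'))
    rw [e1, e2, ← htrans (fun s => ξ * g s) (continuous_const.mul hg.continuous)]
    refine eLpNorm_mono_ae ?_
    filter_upwards [ae_planeToComplex_notMem_frontier h0 h1] with x ⟨hx0, hxf⟩
    rw [hgradu x hx0 hxf]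
    refine le_trans ?_ (norm_le_norm_polarField _ _ _)
    rw [norm_mul, norm_mul]
    refine mul_le_mul_of_nonneg_right ?_ (norm_nonneg _)
    have hdiv : ∀ r c : ℝ, 0 < |c| → |c| ≤ 1 → |ξ * g (Real.log ‖planeToComplex x‖) * r| ≤
        |g (Real.log ‖planeToComplex x‖) * (ξ * r / c)| := by
      intro r c hc0 hc1
      rw [show g (Real.log ‖planeToComplex x‖) * (ξ * r / c) =
        ξ * g (Real.log ‖planeToComplex x‖) * r / c by ring, abs_div]
      exact le_div_self (abs_nonneg _) hc0 hc1
    rw [Real.norm_eq_abs, Real.norm_eq_abs]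
    by_cases hs : planeToComplex x ∈ complexSector α
    · simp only [sectorPolar, angular, hs, piecewise_eq_of_mem]
      exact hdiv _ _ (abs_pos.2 hβ1') (abs_le.2 ⟨by linarith, by linarith⟩)
    · simp only [sectorPolar, angular, hs, not_false_iff, piecewise_eq_of_notMem]
      exact hdiv _ _ (abs_pos.2 hβ0.ne') (abs_le.2 ⟨by linarith, by linarith⟩)
  have hUne : U ≠ 0 := by
    rintro rfl
    rw [map_zero, eLpNorm_congr_ae (Lp.coeFn_zero Plane 2 (volOn Ω)), eLpNorm_zero,
      nonpos_iff_eq_zero, mul_eq_zero, mul_eq_zero, ENNReal.ofReal_eq_zero] at hUge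
    rcases hUge with h | h | h
    · exact hC0 h
    · linarith
    · exact hgne h
  refine exists_unit_of_norm_le hUne ?_ ?_
  · refine (norm_smul_sub_poincareOp_le hDm hF hψK (Eventually.of_forall fun x => ?_)).trans ?_
    · simp [F]
    · rw [Lp.norm_toLp, norm_eq U, Lp.norm_def, ← ENNReal.toReal_ofReal hε.le,
        ← ENNReal.toReal_mul]
      refine ENNReal.toReal_mono (ENNReal.mul_ne_top ENNReal.ofReal_ne_top (Lp.eLpNorm_ne_top _)) ?_
      refine hFle.trans (le_trans (le_of_eq ?_) (mul_le_mul_right hUge (ENNReal.ofReal ε)))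
      rw [ENNReal.ofReal_mul hε.le]
      ring
  · filter_upwards [hU] with x hx hxε
    rw [hx]
    refine hgrad0 x fun h => ?_
    have := hus h
    rw [mem_closedBall_zero_iff] at this
    linarith

/-- The same ξ serves both values: the mode even about the bisector handles β, the odd one 1 - β.
Exchanging cosh and sinh exchanges β and 1 - β in the flux condition. -/
theorem isApproxEigenvalueAtZero_of_lt_half (hD : IsCornerInclusion Ω D α) {β : ℝ}
    (hβ : α / (2 * Real.pi) < β) (hβ' : β < 1 / 2) :
    IsApproxEigenvalueAtZero Ω D β ∧ IsApproxEigenvalueAtZero Ω D (1 - β) := by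
  have h0 := hD.angle_pos
  have h1 := hD.angle_lt
  have hβ0 : 0 < β := lt_trans (by positivity) hβ
  have hβ1 : β - 1 ≠ 0 := by linarith
  obtain ⟨ξ, hξ, hrel⟩ := exists_sinh_eq_mul_sinh h0 h1 (μ := 1 - 2 * β) (by linarith) (by
    have : α / (2 * Real.pi) = α / Real.pi / 2 := by field_simp
    linarith)
  set A := ξ * (α / 2) with hA
  set B := ξ * (Real.pi - α / 2) with hB
  have hA0 : 0 < A := by positivity
  have hB0 : 0 < B := mul_pos hξ (by linarith)
  -- Flux continuity, (1 - β) tanh A = β tanh B, recovered from the dispersion relation with ξπ = A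
  -- + B and ξ(π - α) = B - A.
  have hrel' : (1 - β) * (Real.sinh A * Real.cosh B) = β * (Real.sinh B * Real.cosh A) := by
    rw [show ξ * Real.pi = A + B by rw [hA, hB]; ring,
      show ξ * (Real.pi - α) = B - A by rw [hA, hB]; ring, Real.sinh_add, Real.sinh_sub] at hrel
    linarith
  have hcA := (Real.cosh_pos A).ne'
  have hcB := (Real.cosh_pos B).ne'
  have hsA := (Real.sinh_pos_iff.2 hA0).ne'
  have hsB := (Real.sinh_pos_iff.2 hB0).ne'
  have hlin : ∀ s : ℝ, HasDerivAt (fun s => ξ * s) ξ s := fun s => by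
    simpa using (hasDerivAt_id s).const_mul ξ
  have hch : ∀ s, HasDerivAt (fun s => Real.cosh (ξ * s)) (Real.sinh (ξ * s) * ξ) s := fun s =>
    (hlin s).cosh
  have hsh : ∀ s, HasDerivAt (fun s => Real.sinh (ξ * s)) (Real.cosh (ξ * s) * ξ) s := fun s =>
    (hlin s).sinh
  have cch : ContDiff ℝ 1 fun s => Real.cosh (ξ * s) := (contDiff_const.mul contDiff_id).cosh
  have csh : ContDiff ℝ 1 fun s => Real.sinh (ξ * s) := (contDiff_const.mul contDiff_id).sinh
  have eA : ξ * -(α / 2) = -A := by rw [hA]; ring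
  have eB : ξ * (α / 2 - Real.pi) = -B := by rw [hB]; ring
  have hξ0 := hξ.ne'
  have hβ00 := hβ0.ne'
  have hβ3 : 1 - β ≠ 0 := by linarith
  constructor
  -- Even mode, normalized to the value 1 on both sides of the sector.
  · refine isApproxEigenvalueAtZero_of_angular_mode hD hβ0 (by linarith) hξ
      (P := fun s => (Real.cosh A)⁻¹ * Real.cosh (ξ * s))
      (Q := fun s => (Real.cosh B)⁻¹ * Real.cosh (ξ * s))
      (R := fun s => (β - 1) * (Real.cosh A)⁻¹ * Real.sinh (ξ * s))
      (S := fun s => β * (Real.cosh B)⁻¹ * Real.sinh (ξ * s))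
      (contDiff_const.mul cch) (contDiff_const.mul cch)
      (contDiff_const.mul csh) (contDiff_const.mul csh)
      (fun s => ((hch s).const_mul _).congr_deriv (by field_simp))
      (fun s => ((hch s).const_mul _).congr_deriv (by field_simp))
      (fun s => ((hsh s).const_mul _).congr_deriv (by ring))
      (fun s => ((hsh s).const_mul _).congr_deriv (by ring)) ?_ ?_ ?_ ?_ ?_
    · simp only [eB, ← hA, Real.cosh_neg]; field_simp
    · simp only [eA, ← hB, Real.cosh_neg]; field_simp
    · simp only [eB, ← hA, Real.sinh_neg]; field_simp; linarith
    · simp only [eA, ← hB, Real.sinh_neg]; field_simp; linarith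
    · intro θ hθ
      exact mul_ne_zero (mul_ne_zero hβ1 (inv_ne_zero hcA))
        (Real.sinh_pos_iff.2 (mul_pos hξ hθ.1)).ne'
  -- Odd mode, with values ±1 on the two sides; the minus sign in `Q` compensates for arg(-z) being
  -- negative at the upper side.
  · refine isApproxEigenvalueAtZero_of_angular_mode hD (β := 1 - β) (by linarith) (by linarith) hξ
      (P := fun s => (Real.sinh A)⁻¹ * Real.sinh (ξ * s))
      (Q := fun s => -(Real.sinh B)⁻¹ * Real.sinh (ξ * s))
      (R := fun s => (1 - β - 1) * (Real.sinh A)⁻¹ * Real.cosh (ξ * s))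
      (S := fun s => -(1 - β) * (Real.sinh B)⁻¹ * Real.cosh (ξ * s))
      (contDiff_const.mul csh) (contDiff_const.mul csh)
      (contDiff_const.mul cch) (contDiff_const.mul cch)
      (fun s => ((hsh s).const_mul _).congr_deriv (by
        have : 1 - β - 1 ≠ 0 := by simpa using hβ00
        field_simp))
      (fun s => ((hsh s).const_mul _).congr_deriv (by field_simp))
      (fun s => ((hch s).const_mul _).congr_deriv (by ring))
      (fun s => ((hch s).const_mul _).congr_deriv (by ring)) ?_ ?_ ?_ ?_ ?_
    · simp only [eB, ← hA, Real.sinh_neg]; field_simp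
    · simp only [eA, ← hB, Real.sinh_neg]; field_simp
    · simp only [eB, ← hA, Real.cosh_neg]; field_simp; linarith
    · simp only [eA, ← hB, Real.cosh_neg]; field_simp; linarith
    · intro θ _
      exact mul_ne_zero (mul_ne_zero (by simpa using hβ00) (inv_ne_zero hsA))
        (Real.cosh_pos _).ne'

end SobolevH10

theorem mainTheorem2 (Ω : BoundedOpen)
    (hΩ : ∀ p ∈ frontier Ω.carrier, SmoothBoundaryAt Ω.carrier p)
    (D : Set Plane) (α : ℝ) (hD : IsCornerInclusion Ω D α) :
    ∀ t ∈ Set.Icc (lambdaMinus α) (lambdaPlus α),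
      1 / 2 - t ∈ essentialSpectrum (SobolevH10.poincareOp Ω D) := by
  rintro t ⟨ht1, ht2⟩
  have h1 := hD.angle_lt
  set c := α / (2 * Real.pi) with hc
  have hc1 : c < 1 / 2 := by
    rw [hc, div_lt_iff₀ (by positivity)]
    linarith
  have he : α / Real.pi = 2 * c := by rw [hc]; field_simp
  rw [lambdaMinus, he] at ht1
  rw [lambdaPlus, he] at ht2
  refine SobolevH10.IsApproxEigenvalueAtZero.mem_essentialSpectrum ?_
  -- The modes cover [c, 1 - c] except c, 1/2 and 1 - c, where no positive ξ is supplied; closedness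
  -- fills these in.
  refine closure_minimal (s := Ioo c (1 / 2) ∪ Ioo (1 / 2) (1 - c)) ?_
    (SobolevH10.isClosed_isApproxEigenvalueAtZero Ω D) ?_
  · rintro β (hβ | hβ)
    · exact (SobolevH10.isApproxEigenvalueAtZero_of_lt_half hD hβ.1 hβ.2).1
    · have := (SobolevH10.isApproxEigenvalueAtZero_of_lt_half hD (β := 1 - β)
        (by linarith [hβ.2]) (by linarith [hβ.1])).2
      rwa [sub_sub_cancel] at this
  · rw [closure_union, closure_Ioo hc1.ne, closure_Ioo (by linarith)]
    rcases le_total 0 t with h | h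
    · exact Or.inl ⟨by linarith, by linarith⟩
    · exact Or.inr ⟨by linarith, by linarith⟩
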